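/- Let $I=(0,\infty)$ and let $\mathcal D$ be the space of all (locally) absolutely continuous functions $u:I\to\mathbb R$ with $\int_0^\infty u'(x)^2x^2\,dx<\infty$ and $\int_0^\infty u(x)^2\,2x^2\,dx<\infty$. For $u,v\in\mathcal D$ and $\lambda\ge 0$ put $$\mathcal E_\lambda(u,v)=\int_0^\infty u'(x)v'(x)\,x^2\,dx+\lambda\int_0^\infty u(x)v(x)\,2x^2\,dx ,\qquad \mathcal E_\lambda[u]=\mathcal E_\lambda(u,u);$$ $\mathcal E=\mathcal E_0$ with domain $\mathcal D$ is the Dirichlet form of the three-dimensional Bessel process in $L^2(I,2x^2dx)$. Let $(a_k)_{k\ge1}$ be any sequence of strictly positive real numbers, and let $$\mu=x^2\mathbf 1_{(0,1)}(x)\,dx+\sum_{k=1}^\infty a_k\delta_k ,$$ a measure with support $F=[0,1]\cup\mathbb N$. Let $Ju=u|_F\in L^2(F,\mu)$ for $u\in D(J)=\{u\in\mathcal D: u|_F\in L^2(F,\mu)\}$, and for $\lambda>0$ let $P_\lambda$ be the orthogonal projection in $(\mathcal D,\mathcal E_\lambda)$ onto the orthogonal complement of $\ker J$. Let $\check{\mathcal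 E}_\lambda$ be the form in $L^2(F,\mu)$ with domain $\operatorname{ran}J$ given by $\check{\mathcal E}_\lambda[Ju]=\mathcal E_\lambda[P_\lambda u]$. The trace $\check{\mathcal E}$ of $\mathcal E$ with respect to $\mu$ is the Mosco limit of $\check{\mathcal E}_\lambda$ as $\lambda\downarrow0$ (the forms being extended by $+\infty$ off their domains). Then this Mosco limit exists and is unique, and $\check{\mathcal E}$ is a Dirichlet form in $L^2(F,\mu)$ (densely defined, closed, Markovian), with domain $\check{\mathcal D}$ say, which is 1. transient: there is a bounded function $g\in L^1(F,\mu)$ with $g>0$ $\mu$-a.e. such that $\int_F|u|\,g\,d\mu\le\sqrt{\check{\mathcal E}[u]}$ for all $u\in\check{\mathcal D}$; 2. irreducible: if a measurable set $A\subset F$ is invariant, that is, if for every $u\in\check{\mathcal D}$ both $\mathbf 1_Au$ and $\mathbf 1_{F\setminus A}u$ belong to $\check{\mathcal D}$ and $\check{\mathcal E}[u]=\check{\mathcal E}[\mathbf 1_Au]+\check{\mathcal E}[\mathbf 1_{F\setminus A}u]$, then $\mu(A)=0$ or $\mu(F\setminus A)=0$. -/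

import Mathlib

open MeasureTheory Filter Topology Set
open scoped ENNReal

noncomputable section

namespace BesselTrace

/-! ### The Bessel Dirichlet form in dimension three

The form is `ℰ[u] = ∫_0^∞ u'(x)² x² dx` in `L²((0,∞), m)`, `dm = 2 x² dx`. Functions on `(0,∞)` are
represented by functions on `ℝ` whose values outside `(0,∞)` are irrelevant throughout. -/

/-- The form domain `𝒟`: the (locally) absolutely continuous functions on `(0,∞)` which have finite
energy and belong to `L²((0,∞), 2 x² dx)`. -/
structure MemBesselDomain (u : ℝ → ℝ) : Prop where
  absCont : ∀ s t : ℝ, 0 < s → s ≤ t → AbsolutelyContinuousOnInterval u s t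
  energy_finite : IntegrableOn (fun x => (deriv u x) ^ 2 * x ^ 2) (Ioi 0)
  sq_integrable : IntegrableOn (fun x => (u x) ^ 2 * (2 * x ^ 2)) (Ioi 0)

/-- The scalar product `ℰ_lam(u,v) = ∫ u' v' x² dx + lam ∫ u v 2x² dx` on `𝒟`. -/
def besselForm (lam : ℝ) (u v : ℝ → ℝ) : ℝ :=
  (∫ x in Ioi (0 : ℝ), deriv u x * deriv v x * x ^ 2) +
    lam * ∫ x in Ioi (0 : ℝ), u x * v x * (2 * x ^ 2)

/-! ### The measure of mixed type -/

/-- `μ = x² 1_{(0,1)} dx + ∑_{k ≥ 1} a_k δ_k`, seen as a measure on `ℝ`. It is concentrated on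
`F = [0,1] ∪ ℕ`, so that `L²(F,μ)` is `Lp ℝ 2 (mixedMeasure a)`. -/
def mixedMeasure (a : ℕ+ → ℝ) : Measure ℝ :=
  (volume.restrict (Ioo (0 : ℝ) 1)).withDensity (fun x => ENNReal.ofReal (x ^ 2)) +
    Measure.sum fun k : ℕ+ => ENNReal.ofReal (a k) • Measure.dirac ((k : ℕ) : ℝ)

/-! ### The trace of the Bessel form with respect to a measure -/

/-- `u ∈ D(J)` and `J u = f`, where `J` is the restriction operator from `𝒟 ∩ L²(μ)` to `L²(μ)`. -/
def IsRestriction (μ : Measure ℝ) (u : ℝ → ℝ) (f : Lp ℝ 2 μ) : Prop :=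
  MemBesselDomain u ∧ MemLp u 2 μ ∧ f =ᵐ[μ] u

/-- The kernel of the restriction operator `J`. -/
def MemKer (μ : Measure ℝ) (w : ℝ → ℝ) : Prop :=
  MemBesselDomain w ∧ w =ᵐ[μ] 0

/-- `v = P_lam u`: `v` is the orthogonal projection of `u`, in `(𝒟, ℰ_lam)`, onto the orthogonal
complement of `ker J`. -/
def IsProjection (μ : Measure ℝ) (lam : ℝ) (u v : ℝ → ℝ) : Prop :=
  MemBesselDomain v ∧ MemKer μ (u - v) ∧ ∀ w, MemKer μ w → besselForm lam v w = 0

/-- The form given by `J u ↦ ℰ_lam[P_lam u]` on the range of `J`, extended by `⊤` to the other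
elements of `L²(μ)`. (The infimum is over a set of at most one value: `P_lam u` and its energy depend
on `J u` only. It is `⊤` when the set is empty.) -/
def traceApprox (μ : Measure ℝ) (lam : ℝ) (f : Lp ℝ 2 μ) : ℝ≥0∞ :=
  sInf {e | ∃ u v : ℝ → ℝ, IsRestriction μ u f ∧ IsProjection μ lam u v ∧
    e = ENNReal.ofReal (besselForm lam v v)}

/-- Mosco convergence of a sequence of `[0,∞]`-valued functionals on a real Hilbert space. -/
structure MoscoTendsto {H : Type*} [NormedAddCommGroup H] [InnerProductSpace ℝ H]
    (Q : ℕ → H → ℝ≥0∞) (q : H → ℝ≥0∞) : Prop where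
  le_liminf : ∀ (u : ℕ → H) (u₀ : H),
    (∀ v : H, Tendsto (fun n => inner ℝ (u n) v) atTop (𝓝 (inner ℝ u₀ v))) →
      q u₀ ≤ liminf (fun n => Q n (u n)) atTop
  exists_recovery : ∀ u₀ : H, ∃ u : ℕ → H, Tendsto u atTop (𝓝 u₀) ∧
    limsup (fun n => Q n (u n)) atTop ≤ q u₀

/-- `q` is the trace of the Bessel form with respect to `μ`: the Mosco limit of the forms
`traceApprox μ lam` as `lam ↓ 0`. A form with domain `{f | q f ≠ ⊤}` is encoded by its quadratic
functional with the value `⊤` off the domain. -/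
def IsTraceForm (μ : Measure ℝ) (q : Lp ℝ 2 μ → ℝ≥0∞) : Prop :=
  ∀ lam : ℕ → ℝ, (∀ n, 0 < lam n) → Tendsto lam atTop (𝓝 0) →
    MoscoTendsto (fun n => traceApprox μ (lam n)) q

/-! ### Dirichlet forms, transience, irreducibility -/

section General

variable {X : Type*} [MeasurableSpace X] {μ : Measure X}

/-- Dirichlet forms on `L²(μ)`: nonnegative quadratic forms which are closed (that is, lower
semicontinuous), densely defined and Markovian. -/
structure IsDirichletForm (q : Lp ℝ 2 μ → ℝ≥0∞) : Prop where
  parallelogram : ∀ u v, q (u + v) + q (u - v) = 2 * (q u + q v)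
  homogeneous : ∀ (c : ℝ) (u), q (c • u) = ENNReal.ofReal (c ^ 2) * q u
  closed : LowerSemicontinuous q
  dense : Dense {u | q u ≠ ⊤}
  markovian : ∀ u v : Lp ℝ 2 μ, (v =ᵐ[μ] fun x => min (max (u x) 0) 1) → q v ≤ q u

/-- Transience: there is a bounded, integrable, a.e. strictly positive function `g` such that
`∫ |u| g dμ ≤ √(q u)` for all `u` in the domain. -/
def IsTransient (q : Lp ℝ 2 μ → ℝ≥0∞) : Prop :=
  ∃ g : X → ℝ, Measurable g ∧ (∃ C : ℝ, ∀ x, |g x| ≤ C) ∧ Integrable g μ ∧ (∀ᵐ x ∂μ, 0 < g x) ∧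
    ∀ u : Lp ℝ 2 μ, q u ≠ ⊤ → (∫⁻ x, ENNReal.ofReal (|u x| * g x) ∂μ) ^ 2 ≤ q u

/-- The element `1_A u` of `L²(μ)`. -/
def restrictLp (A : Set X) (hA : MeasurableSet A) (u : Lp ℝ 2 μ) : Lp ℝ 2 μ :=
  ((Lp.memLp u).indicator hA).toLp (A.indicator u)

/-- `A` is invariant: for `u` in the domain, `1_A u` and `1_{Aᶜ} u` are in the domain and
`q[u] = q[1_A u] + q[1_{Aᶜ} u]`. -/
def IsInvariant (q : Lp ℝ 2 μ → ℝ≥0∞) (A : Set X) (hA : MeasurableSet A) : Prop :=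
  ∀ u : Lp ℝ 2 μ, q u ≠ ⊤ →
    q (restrictLp A hA u) ≠ ⊤ ∧ q (restrictLp Aᶜ hA.compl u) ≠ ⊤ ∧
      q u = q (restrictLp A hA u) + q (restrictLp Aᶜ hA.compl u)

/-- Irreducibility: every invariant set is null or has null complement. -/
def IsIrreducible (q : Lp ℝ 2 μ → ℝ≥0∞) : Prop :=
  ∀ (A : Set X) (hA : MeasurableSet A), IsInvariant q A hA → μ A = 0 ∨ μ Aᶜ = 0

end General

end BesselTrace

end

noncomputable section

namespace BesselTrace

/-! The Mosco limit is explicit: it is `traceForm`, the least energy of a finite-energy function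
vanishing at infinity that agrees with f μ-almost everywhere. Such functions are u(x) = -∫_x^∞
h(y)/y dy with h = x u' in L², and Cauchy-Schwarz gives u(x)² ≤ ‖h‖²/x (`primitive_sq_le`). This
bound makes evaluation continuous in h, yields transience, and controls the decay of u.

Mosco convergence: `traceApprox` dominates `traceForm`, which is weakly lower semicontinuous because
the relation between h and f is closed and balls are weakly compact
(`exists_mem_of_weakly_tendsto`). For recovery, a near-minimiser need not lie in L²(2x² dx), but its
soft threshold at level ε does, since it vanishes beyond E/ε²; with lam = ε^8 the mass term tends to
0 (`memBesselDomain_softThreshold`). The Dirichlet properties come from operating on competitors in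
the infimum.

Irreducibility: for invariant A, multiplication by 1_A - 1_{Aᶜ} preserves the form. If A separated
the ends of a gap (k, k+1), a near-minimal extension of the signed cutoff would cross zero there;
its absolute value, flattened to 1 over the gap, saves a fixed amount of energy, a contradiction
(`mem_iff_mem_of_gap`). On (0,1) the extension is continuous with values ±1 where the cutoff is 1,
so its sign is constant (`ae_mem_iff_of_interval`). The atoms link the pieces. -/

/-! ### Functions of finite energy as primitives

A function `u` of finite energy which vanishes at infinity is encoded by `h(x) = x u'(x)`, an element
of `L²((0,∞))` whose squared norm is the energy of `u`. -/

/-- The Hilbert space `L²((0,∞))`. -/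
abbrev EnergySpace := Lp ℝ 2 (volume.restrict (Ioi (0 : ℝ)))

lemma integrableOn_inv_sq {x : ℝ} (hx : 0 < x) :
    IntegrableOn (fun y : ℝ => (y ^ 2)⁻¹) (Ioi x) := by
  refine (integrableOn_Ioi_rpow_of_lt (a := -2) (by norm_num) hx).congr_fun (fun y hy => ?_)
    measurableSet_Ioi
  have hy0 : 0 < y := hx.trans hy
  simp only [Real.rpow_neg hy0.le]
  norm_cast

lemma integral_inv_sq {x : ℝ} (hx : 0 < x) : ∫ y in Ioi x, (y ^ 2)⁻¹ = x⁻¹ := by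
  have h := integral_Ioi_rpow_of_lt (a := -2) (by norm_num) hx
  rw [show (-2 + 1 : ℝ) = -1 by norm_num, Real.rpow_neg_one] at h
  rw [← (by simpa using h : ∫ y in Ioi x, y ^ (-2 : ℝ) = x⁻¹)]
  refine setIntegral_congr_fun measurableSet_Ioi (fun y hy => ?_)
  have hy0 : 0 < y := hx.trans hy
  simp only [Real.rpow_neg hy0.le]
  norm_cast

/-- The kernel representing the evaluation at `x` of the primitive. -/
def evalKernel (x : ℝ) : ℝ → ℝ := (Ioi x).indicator fun y => -y⁻¹

lemma measurable_evalKernel (x : ℝ) : Measurable (evalKernel x) :=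
  measurable_inv.neg.indicator measurableSet_Ioi

lemma evalKernel_sq (x : ℝ) :
    (fun y => evalKernel x y ^ 2) = (Ioi x).indicator fun y => (y ^ 2)⁻¹ := by
  ext y
  by_cases hy : y ∈ Ioi x <;> simp [evalKernel, hy]

lemma memLp_evalKernel {x : ℝ} (hx : 0 < x) :
    MemLp (evalKernel x) 2 (volume.restrict (Ioi (0 : ℝ))) := by
  rw [memLp_two_iff_integrable_sq (measurable_evalKernel x).aestronglyMeasurable, evalKernel_sq]
  exact ((integrableOn_inv_sq hx).integrable_indicator measurableSet_Ioi).restrict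

/-- The vector representing the evaluation at `x` of the primitive. -/
def evalVec (x : ℝ) : EnergySpace :=
  -- The default 0 makes every primitive vanish on (-∞,0], so that it is measurable on all of ℝ.
  if hx : 0 < x then (memLp_evalKernel hx).toLp _ else 0

/-- The primitive `x ↦ -∫_x^∞ h(y)/y dy`. -/
def primitive (h : EnergySpace) (x : ℝ) : ℝ := inner ℝ (evalVec x) h

lemma coeFn_evalVec {x : ℝ} (hx : 0 < x) :
    evalVec x =ᵐ[volume.restrict (Ioi (0 : ℝ))] evalKernel x := by
  rw [evalVec, dif_pos hx]
  exact MemLp.coeFn_toLp _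

lemma norm_sq_eq_integral {X : Type*} [MeasurableSpace X] {ν : Measure X} (h : Lp ℝ 2 ν) :
    ‖h‖ ^ 2 = ∫ y, h y ^ 2 ∂ν := by
  rw [← real_inner_self_eq_norm_sq, L2.inner_def]
  simp [sq]

lemma inner_eq_integral {X : Type*} [MeasurableSpace X] {ν : Measure X} (f g : Lp ℝ 2 ν) :
    inner ℝ f g = ∫ y, f y * g y ∂ν := by
  rw [L2.inner_def]
  simp [mul_comm]

lemma norm_evalVec_sq {x : ℝ} (hx : 0 < x) : ‖evalVec x‖ ^ 2 = x⁻¹ := by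
  rw [norm_sq_eq_integral, ← integral_inv_sq hx]
  calc ∫ y in Ioi 0, evalVec x y ^ 2 = ∫ y in Ioi 0, evalKernel x y ^ 2 := by
        refine integral_congr_ae ?_
        filter_upwards [coeFn_evalVec hx] with y hy
        rw [hy]
    _ = ∫ y in Ioi x, (y ^ 2)⁻¹ := by
        rw [evalKernel_sq, setIntegral_indicator measurableSet_Ioi,
          inter_eq_right.2 (Ioi_subset_Ioi hx.le)]

@[simp] lemma primitive_add (h k : EnergySpace) : primitive (h + k) = primitive h + primitive k := by
  ext x
  simp [primitive, inner_add_right]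

@[simp] lemma primitive_sub (h k : EnergySpace) : primitive (h - k) = primitive h - primitive k := by
  ext x
  simp [primitive, inner_sub_right]

@[simp] lemma primitive_smul (c : ℝ) (h : EnergySpace) : primitive (c • h) = c • primitive h := by
  ext x
  simp [primitive, inner_smul_right]

@[simp] lemma primitive_zero : primitive 0 = 0 := by
  ext x
  simp [primitive]

lemma primitive_of_nonpos (h : EnergySpace) {x : ℝ} (hx : x ≤ 0) : primitive h x = 0 := by
  simp [primitive, evalVec, not_lt.2 hx]

/-- Cauchy-Schwarz against the evaluation vector, whose squared norm is ∫_x^∞ y⁻² dy = 1/x. -/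
lemma primitive_sq_le (h : EnergySpace) {x : ℝ} (hx : 0 < x) :
    primitive h x ^ 2 ≤ ‖h‖ ^ 2 / x := by
  have h1 := abs_real_inner_le_norm (evalVec x) h
  calc primitive h x ^ 2 = |inner ℝ (evalVec x) h| ^ 2 := by rw [sq_abs, primitive]
    _ ≤ (‖evalVec x‖ * ‖h‖) ^ 2 := by gcongr
    _ = ‖h‖ ^ 2 / x := by rw [mul_pow, norm_evalVec_sq hx]; ring

lemma tendsto_primitive_atTop (h : EnergySpace) : Tendsto (primitive h) atTop (𝓝 0) := by
  have h1 : Tendsto (fun x : ℝ => ‖h‖ ^ 2 / x) atTop (𝓝 0) :=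
    tendsto_const_nhds.div_atTop tendsto_id
  have h2 : Tendsto (fun x => primitive h x ^ 2) atTop (𝓝 0) := by
    refine tendsto_of_tendsto_of_tendsto_of_le_of_le' tendsto_const_nhds h1
      (Eventually.of_forall fun x => sq_nonneg _) ?_
    filter_upwards [eventually_gt_atTop 0] with x hx using primitive_sq_le h hx
  have h3 := (Real.continuous_sqrt.tendsto _).comp h2
  simp only [Real.sqrt_zero, Function.comp_def, Real.sqrt_sq_eq_abs] at h3
  exact (tendsto_zero_iff_abs_tendsto_zero _).2 h3

lemma integrableOn_inv_mul (h : EnergySpace) {x : ℝ} (hx : 0 < x) :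
    IntegrableOn (fun y => y⁻¹ * h y) (Ioi x) := by
  have h1 : Integrable (fun y => evalKernel x y * h y) (volume.restrict (Ioi (0 : ℝ))) :=
    (memLp_evalKernel hx).integrable_mul (Lp.memLp h)
  have h2 : IntegrableOn (fun y => evalKernel x y * h y) (Ioi x) :=
    h1.mono_measure (Measure.restrict_mono (Ioi_subset_Ioi hx.le) le_rfl)
  refine h2.neg.congr_fun (fun y hy => ?_) measurableSet_Ioi
  simp [evalKernel, indicator_of_mem hy]

lemma primitive_eq_integral (h : EnergySpace) {x : ℝ} (hx : 0 < x) :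
    primitive h x = -∫ y in Ioi x, y⁻¹ * h y := by
  rw [primitive, inner_eq_integral, ← integral_neg]
  calc ∫ y in Ioi 0, evalVec x y * h y
      = ∫ y in Ioi 0, (Ioi x).indicator (fun y => -(y⁻¹ * h y)) y := by
        refine integral_congr_ae ?_
        filter_upwards [coeFn_evalVec hx] with y hy
        rw [hy]
        by_cases hy' : y ∈ Ioi x <;> simp [evalKernel, hy']
    _ = _ := by
        rw [setIntegral_indicator measurableSet_Ioi, inter_eq_right.2 (Ioi_subset_Ioi hx.le)]

lemma primitive_eq_add_integral (h : EnergySpace) {s t : ℝ} (hs : 0 < s) (hst : s ≤ t) :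
    primitive h t = primitive h s + ∫ y in s..t, y⁻¹ * h y := by
  rw [← intervalIntegral.integral_Ioi_sub_Ioi (integrableOn_inv_mul h hs) hst,
    primitive_eq_integral h hs, primitive_eq_integral h (hs.trans_le hst)]
  ring

lemma intervalIntegrable_inv_mul (h : EnergySpace) {s t : ℝ} (hs : 0 < s) (hst : s ≤ t) :
    IntervalIntegrable (fun y => y⁻¹ * h y) volume s t :=
  (intervalIntegrable_iff_integrableOn_Ioc_of_le hst).2
    ((integrableOn_inv_mul h hs).mono_set Ioc_subset_Ioi_self)

/-! ### Absolute continuity and derivatives of primitives. -/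

lemma absolutelyContinuousOnInterval_congr {u v : ℝ → ℝ} {s t : ℝ}
    (hu : AbsolutelyContinuousOnInterval u s t) (huv : EqOn u v (uIcc s t)) :
    AbsolutelyContinuousOnInterval v s t := by
  rw [absolutelyContinuousOnInterval_iff] at hu ⊢
  intro ε hε
  obtain ⟨δ, hδ, h⟩ := hu ε hε
  refine ⟨δ, hδ, fun E hE hEδ => ?_⟩
  convert! h E hE hEδ using 1
  refine Finset.sum_congr rfl fun i hi => ?_
  rw [huv (hE.1 i hi).1, huv (hE.1 i hi).2]

lemma absolutelyContinuousOnInterval_comp {φ u : ℝ → ℝ} {s t : ℝ}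
    (hφ : ∀ x y, |φ x - φ y| ≤ |x - y|) (hu : AbsolutelyContinuousOnInterval u s t) :
    AbsolutelyContinuousOnInterval (fun x => φ (u x)) s t := by
  rw [absolutelyContinuousOnInterval_iff] at hu ⊢
  intro ε hε
  obtain ⟨δ, hδ, h⟩ := hu ε hε
  refine ⟨δ, hδ, fun E hE hEδ => lt_of_le_of_lt ?_ (h E hE hEδ)⟩
  exact Finset.sum_le_sum fun i _ => hφ _ _

lemma absolutelyContinuousOnInterval_primitive (h : EnergySpace) {s t : ℝ} (hs : 0 < s)
    (hst : s ≤ t) : AbsolutelyContinuousOnInterval (primitive h) s t := by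
  have h1 := (intervalIntegrable_inv_mul h hs
    hst).absolutelyContinuousOnInterval_intervalIntegral (c := s) left_mem_uIcc
  have h2 : AbsolutelyContinuousOnInterval (fun _ : ℝ => primitive h s) s t :=
    contDiffOn_const.absolutelyContinuousOnInterval
  refine absolutelyContinuousOnInterval_congr (h2.add h1) fun x hx => ?_
  rw [uIcc_of_le hst] at hx
  exact (primitive_eq_add_integral h hs hx.1).symm

lemma continuousOn_primitive (h : EnergySpace) : ContinuousOn (primitive h) (Ioi 0) := by
  intro x hx
  have hx : 0 < x := hx
  have h1 := (absolutelyContinuousOnInterval_primitive h (half_pos hx)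
    (by linarith : x / 2 ≤ x + 1)).continuousOn
  rw [uIcc_of_le (by linarith : x / 2 ≤ x + 1)] at h1
  exact (h1.continuousAt (Icc_mem_nhds (by linarith) (by linarith))).continuousWithinAt

lemma measurable_primitive (h : EnergySpace) : Measurable (primitive h) := by
  refine measurable_of_restrict_of_restrict_compl (measurableSet_Ioi (a := (0 : ℝ)))
    (continuousOn_iff_continuous_domRestrict.1 (continuousOn_primitive h)).measurable ?_
  have : (Ioi (0 : ℝ))ᶜ.domRestrict (primitive h) = fun _ => 0 := by
    ext x
    exact primitive_of_nonpos h (not_lt.1 x.2)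
  rw [this]
  exact measurable_const

/-- The intervals [1/(n+1), n+1] exhaust (0,∞) countably. -/
lemma ae_Ioi_of_forall_Icc {p : ℝ → Prop}
    (hp : ∀ s t : ℝ, 0 < s → s ≤ t → ∀ᵐ x, x ∈ Icc s t → p x) :
    ∀ᵐ x ∂volume.restrict (Ioi (0 : ℝ)), p x := by
  rw [ae_restrict_iff' measurableSet_Ioi]
  have h1 : ∀ n : ℕ, ∀ᵐ x, x ∈ Icc (((n : ℝ) + 1)⁻¹) ((n : ℝ) + 1) → p x := fun n => by
    refine hp _ _ (by positivity) ?_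
    have : (1 : ℝ) ≤ (n : ℝ) + 1 := by linarith [n.cast_nonneg (α := ℝ)]
    exact (inv_le_one_of_one_le₀ this).trans this
  filter_upwards [ae_all_iff.2 h1] with x hx hx0
  have hx0 : 0 < x := hx0
  obtain ⟨n, hn⟩ := exists_nat_gt (max x x⁻¹)
  refine hx n ⟨?_, ?_⟩
  · exact inv_le_of_inv_le₀ hx0 (by linarith [le_max_right x x⁻¹])
  · linarith [le_max_left x x⁻¹]

lemma ae_differentiableAt_of_absCont {u : ℝ → ℝ}
    (hu : ∀ s t : ℝ, 0 < s → s ≤ t → AbsolutelyContinuousOnInterval u s t) :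
    ∀ᵐ x ∂volume.restrict (Ioi (0 : ℝ)), DifferentiableAt ℝ u x := by
  refine ae_Ioi_of_forall_Icc fun s t hs hst => ?_
  have := (hu s t hs hst).ae_differentiableAt
  rwa [uIcc_of_le hst] at this

lemma deriv_congr_of_eqOn_Ioi {u v : ℝ → ℝ} (huv : EqOn u v (Ioi 0)) {x : ℝ} (hx : 0 < x) :
    deriv u x = deriv v x :=
  (huv.eventuallyEq_of_mem (Ioi_mem_nhds hx)).deriv_eq

/-- If `u` is the primitive of `h` then `h(x) = x u'(x)`. -/
lemma coeFn_eq_mul_deriv {u : ℝ → ℝ} {h : EnergySpace} (hu : EqOn u (primitive h) (Ioi 0)) :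
    h =ᵐ[volume.restrict (Ioi (0 : ℝ))] fun x => x * deriv u x := by
  have h1 : ∀ᵐ x ∂volume.restrict (Ioi (0 : ℝ)), HasDerivAt (primitive h) (x⁻¹ * h x) x := by
    refine ae_Ioi_of_forall_Icc fun s t hs hst => ?_
    -- Basing the integral at s/2 makes the primitive formula valid in a neighbourhood of every x in
    -- [s,t], including s.
    have hs2 : 0 < s / 2 := half_pos hs
    have hst2 : s / 2 ≤ t := by linarith
    filter_upwards [(intervalIntegrable_inv_mul h hs2 hst2).ae_hasDerivAt_integral] with x hx hxs
    rw [uIcc_of_le hst2] at hx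
    have h2 := hx ⟨by linarith [hxs.1], hxs.2⟩ (s / 2) ⟨le_rfl, hst2⟩
    refine (h2.const_add (primitive h (s / 2))).congr_of_eventuallyEq ?_
    filter_upwards [Ioi_mem_nhds (show s / 2 < x by linarith [hxs.1])] with y hy
    exact primitive_eq_add_integral h hs2 (le_of_lt hy)
  filter_upwards [h1, ae_restrict_mem measurableSet_Ioi] with x hx hx0
  have hx0 : 0 < x := hx0
  rw [deriv_congr_of_eqOn_Ioi hu hx0, hx.deriv, mul_inv_cancel_left₀ hx0.ne']

/-! ### Primitives as the finite-energy functions vanishing at infinity. -/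

/-- Functions of finite energy on `(0,∞)` which vanish at infinity. -/
structure MemExtended (u : ℝ → ℝ) : Prop where
  absCont : ∀ s t : ℝ, 0 < s → s ≤ t → AbsolutelyContinuousOnInterval u s t
  energy_finite : IntegrableOn (fun x => (deriv u x) ^ 2 * x ^ 2) (Ioi 0)
  tendsto_zero : Tendsto u atTop (𝓝 0)

lemma norm_sq_eq_energy {u : ℝ → ℝ} {h : EnergySpace} (hu : EqOn u (primitive h) (Ioi 0)) :
    ‖h‖ ^ 2 = ∫ x in Ioi (0 : ℝ), (deriv u x) ^ 2 * x ^ 2 := by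
  rw [norm_sq_eq_integral]
  refine integral_congr_ae ?_
  filter_upwards [coeFn_eq_mul_deriv hu] with x hx
  rw [hx]
  ring

lemma MemExtended.of_eqOn_primitive {u : ℝ → ℝ} {h : EnergySpace}
    (hu : EqOn u (primitive h) (Ioi 0)) : MemExtended u where
  absCont s t hs hst := by
    refine absolutelyContinuousOnInterval_congr (absolutelyContinuousOnInterval_primitive h hs hst)
      fun x hx => (hu ?_).symm
    rw [uIcc_of_le hst] at hx
    exact hs.trans_le hx.1
  energy_finite := by
    refine ((Lp.memLp h).integrable_sq).congr ?_
    filter_upwards [coeFn_eq_mul_deriv hu] with x hx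
    rw [hx]
    ring
  tendsto_zero := by
    refine (tendsto_primitive_atTop h).congr' ?_
    filter_upwards [eventually_gt_atTop 0] with x hx using (hu hx).symm

lemma memLp_mul_deriv {u : ℝ → ℝ}
    (hu : IntegrableOn (fun x => (deriv u x) ^ 2 * x ^ 2) (Ioi 0)) :
    MemLp (fun x => x * deriv u x) 2 (volume.restrict (Ioi (0 : ℝ))) := by
  have hm : Measurable fun x => x * deriv u x := measurable_id.mul (measurable_deriv u)
  rw [memLp_two_iff_integrable_sq hm.aestronglyMeasurable]
  refine hu.congr (Eventually.of_forall fun x => ?_)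
  simp only [mul_pow]
  ring

/-- A function of finite energy has a limit at infinity, and it is a primitive up to this limit. -/
lemma exists_eq_primitive_add {u : ℝ → ℝ}
    (hac : ∀ s t : ℝ, 0 < s → s ≤ t → AbsolutelyContinuousOnInterval u s t)
    (hu : IntegrableOn (fun x => (deriv u x) ^ 2 * x ^ 2) (Ioi 0)) :
    ∃ (h : EnergySpace) (c : ℝ), ∀ x, 0 < x → u x = primitive h x + c := by
  set h : EnergySpace := (memLp_mul_deriv hu).toLp _ with hh
  have hcoe : h =ᵐ[volume.restrict (Ioi (0 : ℝ))] fun x => x * deriv u x := MemLp.coeFn_toLp _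
  refine ⟨h, u 1 - primitive h 1, ?_⟩
  have key : ∀ s t : ℝ, 0 < s → s ≤ t → u t - u s = primitive h t - primitive h s := by
    intro s t hs hst
    rw [primitive_eq_add_integral h hs hst, ← (hac s t hs hst).integral_deriv_eq_sub,
      add_sub_cancel_left]
    rw [intervalIntegral.integral_of_le hst, intervalIntegral.integral_of_le hst]
    have h1 : volume.restrict (Ioc s t) ≤ volume.restrict (Ioi (0 : ℝ)) :=
      Measure.restrict_mono (fun x hx => hs.trans hx.1) le_rfl
    refine integral_congr_ae ?_
    filter_upwards [hcoe.filter_mono (ae_mono h1), ae_restrict_mem measurableSet_Ioc] with x hx hx0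
    rw [hx, inv_mul_cancel_left₀ (hs.trans hx0.1).ne']
  intro x hx
  rcases le_total x 1 with h1 | h1
  · linarith [key x 1 hx h1]
  · linarith [key 1 x one_pos h1]

lemma MemExtended.exists_primitive {u : ℝ → ℝ} (hu : MemExtended u) :
    ∃ h : EnergySpace, EqOn u (primitive h) (Ioi 0) := by
  obtain ⟨h, c, hc⟩ := exists_eq_primitive_add hu.absCont hu.energy_finite
  have h1 : Tendsto u atTop (𝓝 (0 + c)) := by
    refine ((tendsto_primitive_atTop h).add_const c).congr' ?_
    filter_upwards [eventually_gt_atTop 0] with x hx using (hc x hx).symm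
  have h2 := tendsto_nhds_unique h1 hu.tendsto_zero
  refine ⟨h, fun x hx => ?_⟩
  rw [hc x hx]
  linarith

/-- Finite energy forces a limit c at infinity. If c ≠ 0, then u² · 2x² tends to infinity, against
its integrability. -/
lemma MemBesselDomain.memExtended {u : ℝ → ℝ} (hu : MemBesselDomain u) : MemExtended u := by
  refine ⟨hu.absCont, hu.energy_finite, ?_⟩
  obtain ⟨h, c, hc⟩ := exists_eq_primitive_add hu.absCont hu.energy_finite
  have h1 : Tendsto u atTop (𝓝 (0 + c)) := by
    refine ((tendsto_primitive_atTop h).add_const c).congr' ?_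
    filter_upwards [eventually_gt_atTop 0] with x hx using (hc x hx).symm
  rw [zero_add] at h1
  suffices c = 0 by rwa [this] at h1
  by_contra hc0
  have h2 : Tendsto (fun x : ℝ => (u x) ^ 2 * (2 * x ^ 2)) atTop atTop :=
    (h1.pow 2).pos_mul_atTop (by positivity)
      ((tendsto_pow_atTop two_ne_zero).const_mul_atTop two_pos)
  obtain ⟨M, hM⟩ := eventually_atTop.1 (h2.eventually_ge_atTop 1)
  have h3 : IntegrableOn (fun _ : ℝ => (1 : ℝ)) (Ioi (max M 0)) := by
    refine (hu.sq_integrable.mono_set (Ioi_subset_Ioi (le_max_right M 0))).mono'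
      aestronglyMeasurable_const ?_
    filter_upwards [ae_restrict_mem measurableSet_Ioi] with x hx
    rw [norm_one]
    exact hM x ((le_max_left M 0).trans (le_of_lt hx))
  simp [integrableOn_const_iff] at h3

/-- Normal contractions operate on the primitives and do not increase the energy. -/
lemma exists_primitive_comp {φ : ℝ → ℝ} (hφ : ∀ x y, |φ x - φ y| ≤ |x - y|) (hφ0 : φ 0 = 0)
    (h : EnergySpace) :
    ∃ k : EnergySpace, (∀ x, primitive k x = φ (primitive h x)) ∧ ‖k‖ ≤ ‖h‖ := by
  set u := primitive h with hu
  have hac : ∀ s t : ℝ, 0 < s → s ≤ t → AbsolutelyContinuousOnInterval u s t :=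
    fun s t hs hst => absolutelyContinuousOnInterval_primitive h hs hst
  -- Where u is differentiable, increments of φ ∘ u are at most (|u'| + ε)|y - x|. This bounds
  -- `deriv` even where φ ∘ u is not differentiable and `deriv` is 0 by default.
  have hd : ∀ᵐ x ∂volume.restrict (Ioi (0 : ℝ)), |deriv (fun x => φ (u x)) x| ≤ |deriv u x| := by
    filter_upwards [ae_differentiableAt_of_absCont hac] with x hx
    refine le_of_forall_pos_le_add fun ε hε => ?_
    refine norm_deriv_le_of_lip' (𝕜 := ℝ) (f := fun x => φ (u x)) (add_nonneg (abs_nonneg _) hε.le) ?_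
    have h1 := hx.hasDerivAt.isLittleO.def hε
    filter_upwards [h1] with y hy
    refine (hφ _ _).trans ?_
    have h2 : |u y - u x| ≤ |u y - u x - (y - x) * deriv u x| + |(y - x) * deriv u x| := by
      simpa using abs_add_le (u y - u x - (y - x) * deriv u x) ((y - x) * deriv u x)
    rw [abs_mul] at h2
    simp only [Real.norm_eq_abs, smul_eq_mul] at hy ⊢
    linarith
  have hd2 : ∀ᵐ x ∂volume.restrict (Ioi (0 : ℝ)),
      (deriv (fun x => φ (u x)) x) ^ 2 * x ^ 2 ≤ (deriv u x) ^ 2 * x ^ 2 := by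
    filter_upwards [hd] with x hx
    have := sq_le_sq.2 hx
    gcongr
  have hext := MemExtended.of_eqOn_primitive (u := u) (h := h) (fun x _ => rfl)
  have hφu : MemExtended fun x => φ (u x) := by
    refine ⟨fun s t hs hst => absolutelyContinuousOnInterval_comp hφ (hac s t hs hst), ?_, ?_⟩
    · refine hext.energy_finite.mono'
        (((measurable_deriv _).pow_const 2).mul
          (measurable_id.pow_const 2)).aestronglyMeasurable ?_
      filter_upwards [hd2] with x hx
      rwa [Real.norm_of_nonneg (by positivity)]
    · refine squeeze_zero_norm (fun x => ?_) ((tendsto_zero_iff_abs_tendsto_zero _).1 hext.tendsto_zero)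
      simpa [hφ0] using hφ (u x) 0
  obtain ⟨k, hk⟩ := hφu.exists_primitive
  refine ⟨k, fun x => ?_, ?_⟩
  · rcases le_or_gt x 0 with hx | hx
    · rw [primitive_of_nonpos k hx, hu, primitive_of_nonpos h hx, hφ0]
    · exact (hk hx).symm
  · rw [← sq_le_sq₀ (norm_nonneg _) (norm_nonneg _), norm_sq_eq_energy hk,
      norm_sq_eq_energy (u := u) (h := h) fun x _ => rfl]
    exact integral_mono_ae hφu.energy_finite hext.energy_finite hd2

/-! ### Weak lower semicontinuity -/

/-- A closed linear relation between Hilbert spaces restricted to a ball of the first space has a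
weakly closed range. -/
lemma exists_mem_of_weakly_tendsto {H G : Type*} [NormedAddCommGroup H] [InnerProductSpace ℝ H]
    [CompleteSpace H] [NormedAddCommGroup G] [InnerProductSpace ℝ G] [CompleteSpace G]
    {Γ : Submodule ℝ (WithLp 2 (H × G))} (hΓ : IsClosed (Γ : Set (WithLp 2 (H × G))))
    {ι : Type*} {l : Filter ι} {f : ι → G} {f₀ : G} {C : ℝ}
    (hf : ∀ g, Tendsto (fun i => inner ℝ (f i) g) l (𝓝 (inner ℝ f₀ g)))
    (hC : ∃ᶠ i in l, ∃ h, WithLp.toLp 2 (h, f i) ∈ Γ ∧ ‖h‖ ≤ C) :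
    ∃ h, WithLp.toLp 2 (h, f₀) ∈ Γ ∧ ‖h‖ ≤ C := by
  classical
  set s : Set ι := {i | ∃ h, WithLp.toLp 2 (h, f i) ∈ Γ ∧ ‖h‖ ≤ C} with hs
  have hne : (l ⊓ 𝓟 s).NeBot := frequently_mem_iff_neBot.1 hC
  -- An ultrafilter on the good indices makes weak-* compactness yield a limit directly, for any
  -- filter `l` and without subsequences.
  set U := Ultrafilter.of (l ⊓ 𝓟 s)
  have hUl : (U : Filter ι) ≤ l := (Ultrafilter.of_le _).trans inf_le_left
  have hUs : ∀ᶠ i in (U : Filter ι), i ∈ s :=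
    (Ultrafilter.of_le (l ⊓ 𝓟 s)).trans inf_le_right (mem_principal_self s)
  let h : ι → H := fun i => if hi : i ∈ s then hi.choose else 0
  have hh : ∀ i ∈ s, WithLp.toLp 2 (h i, f i) ∈ Γ ∧ ‖h i‖ ≤ C := fun i hi => by
    simp only [h, dif_pos hi]
    exact hi.choose_spec
  let T : ι → WeakDual ℝ H := fun i =>
    StrongDual.toWeakDual (InnerProductSpace.toDual ℝ H (h i))
  obtain ⟨x, hx, hxU⟩ := isCompact_iff_ultrafilter_le_nhds.1
    (WeakDual.isCompact_closedBall (0 : StrongDual ℝ H) C) (U.map T) (by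
      rw [le_principal_iff]
      show ∀ᶠ i in (U : Filter ι), T i ∈ _
      filter_upwards [hUs] with i hi
      simpa [T] using (hh i hi).2)
  set h₀ : H := (InnerProductSpace.toDual ℝ H).symm (WeakDual.toStrongDual x) with hh₀
  have hlim : ∀ y, Tendsto (fun i => inner ℝ (h i) y) U (𝓝 (inner ℝ h₀ y)) := by
    intro y
    have h1 : Tendsto (fun i => T i y) U (𝓝 (x y)) :=
      ((WeakDual.eval_continuous y).tendsto x).comp (show Tendsto T U (𝓝 x) from hxU)
    rw [hh₀, InnerProductSpace.toDual_symm_apply]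
    exact h1
  refine ⟨h₀, ?_, ?_⟩
  -- Since Γ = Γᗮᗮ, membership of the weak limit is tested by pairing with Γᗮ, and each such pairing
  -- passes to weak limits.
  · have : CompleteSpace Γ := hΓ.completeSpace_coe
    rw [← Submodule.orthogonal_orthogonal Γ, Submodule.mem_orthogonal']
    intro p hp
    have h1 : Tendsto (fun i => inner ℝ (WithLp.toLp 2 (h i, f i)) p) U
        (𝓝 (inner ℝ (WithLp.toLp 2 (h₀, f₀)) p)) := by
      simp only [WithLp.prod_inner_apply]
      exact (hlim _).add ((hf _).mono_left hUl)
    refine tendsto_nhds_unique (h1.congr' ?_) tendsto_const_nhds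
    filter_upwards [hUs] with i hi
    exact (Submodule.mem_orthogonal _ _).1 hp _ (hh i hi).1
  · rw [hh₀, LinearIsometryEquiv.norm_map]
    simpa using hx

/-! ### The closed relation between `h` and the restriction of its primitive -/

/-- The relation `f = θ · primitive h`, `ν`-almost everywhere. -/
def weightedGraph (ν : Measure ℝ) (θ : ℝ → ℝ) :
    Submodule ℝ (WithLp 2 (EnergySpace × Lp ℝ 2 ν)) where
  carrier := {p | p.snd =ᵐ[ν] fun x => θ x * primitive p.fst x}
  add_mem' {p q} hp hq := by
    have h1 : (p + q).snd =ᵐ[ν] p.snd + q.snd := Lp.coeFn_add _ _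
    refine h1.trans ?_
    filter_upwards [hp, hq] with x hx hy
    simp [hx, hy, mul_add]
  zero_mem' := by
    have h1 : ((0 : WithLp 2 (EnergySpace × Lp ℝ 2 ν)).snd : ℝ → ℝ) =ᵐ[ν] 0 := Lp.coeFn_zero _ _ _
    refine h1.trans (Eventually.of_forall fun x => ?_)
    simp
  smul_mem' c p hp := by
    have h1 : (c • p).snd =ᵐ[ν] c • p.snd := Lp.coeFn_smul _ _
    refine h1.trans ?_
    filter_upwards [hp] with x hx
    simp [hx, mul_left_comm]

lemma mem_weightedGraph {ν : Measure ℝ} {θ : ℝ → ℝ} {p : WithLp 2 (EnergySpace × Lp ℝ 2 ν)} :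
    p ∈ weightedGraph ν θ ↔ p.snd =ᵐ[ν] fun x => θ x * primitive p.fst x := Iff.rfl

lemma tendsto_primitive {ι : Type*} {l : Filter ι} {h : ι → EnergySpace} {h₀ : EnergySpace}
    (hh : Tendsto h l (𝓝 h₀)) (x : ℝ) :
    Tendsto (fun i => primitive (h i) x) l (𝓝 (primitive h₀ x)) :=
  tendsto_const_nhds.inner hh

/-- Evaluation of the primitive is continuous in h at every point, and the second component
converges a.e. along a subsequence. The weight 1 serves the trace form, `besselWeight` the domain 𝒟.
-/
lemma isClosed_weightedGraph (ν : Measure ℝ) (θ : ℝ → ℝ) :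
    IsClosed (weightedGraph ν θ : Set (WithLp 2 (EnergySpace × Lp ℝ 2 ν))) := by
  refine IsSeqClosed.isClosed fun p p₀ hp hlim => ?_
  have h1 : Tendsto (fun n => (p n).fst) atTop (𝓝 p₀.fst) :=
    ((continuous_fst.comp (WithLp.prod_continuous_ofLp 2 _ _)).tendsto p₀).comp hlim
  have h2 : Tendsto (fun n => (p n).snd) atTop (𝓝 p₀.snd) :=
    ((continuous_snd.comp (WithLp.prod_continuous_ofLp 2 _ _)).tendsto p₀).comp hlim
  obtain ⟨ns, hns, hae⟩ := (tendstoInMeasure_of_tendsto_Lp h2).exists_seq_tendsto_ae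
  have h3 : ∀ᵐ x ∂ν, ∀ i, (p (ns i)).snd x = θ x * primitive (p (ns i)).fst x :=
    ae_all_iff.2 fun i => hp (ns i)
  rw [SetLike.mem_coe, mem_weightedGraph]
  filter_upwards [hae, h3] with x hx hx3
  simp only [hx3] at hx
  exact tendsto_nhds_unique hx
    (((tendsto_primitive h1 x).comp hns.tendsto_atTop).const_mul (θ x))

/-- The trace of the Bessel form: the minimal energy of an extension. -/
def traceForm (μ : Measure ℝ) (f : Lp ℝ 2 μ) : ℝ≥0∞ :=
  ⨅ (h : EnergySpace) (_ : f =ᵐ[μ] primitive h), ENNReal.ofReal (‖h‖ ^ 2)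

lemma traceForm_le {μ : Measure ℝ} {f : Lp ℝ 2 μ} {h : EnergySpace} (hf : f =ᵐ[μ] primitive h) :
    traceForm μ f ≤ ENNReal.ofReal (‖h‖ ^ 2) :=
  iInf₂_le h hf

lemma traceForm_ne_top {μ : Measure ℝ} {f : Lp ℝ 2 μ} {h : EnergySpace}
    (hf : f =ᵐ[μ] primitive h) : traceForm μ f ≠ ⊤ :=
  ((traceForm_le hf).trans_lt ENNReal.ofReal_lt_top).ne

lemma traceForm_lt_iff {μ : Measure ℝ} {f : Lp ℝ 2 μ} {c : ℝ≥0∞} :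
    traceForm μ f < c ↔ ∃ h : EnergySpace, f =ᵐ[μ] primitive h ∧ ENNReal.ofReal (‖h‖ ^ 2) < c := by
  simp [traceForm, iInf_lt_iff]

lemma le_traceForm_iff {μ : Measure ℝ} {f : Lp ℝ 2 μ} {c : ℝ≥0∞} :
    c ≤ traceForm μ f ↔
      ∀ h : EnergySpace, f =ᵐ[μ] primitive h → c ≤ ENNReal.ofReal (‖h‖ ^ 2) := by
  simp [traceForm]

/-- Weak lower semicontinuity of the trace form, along an arbitrary filter. -/
lemma traceForm_le_of_weakly_tendsto {μ : Measure ℝ} {ι : Type*} {l : Filter ι}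
    {f : ι → Lp ℝ 2 μ} {f₀ : Lp ℝ 2 μ} {c : ℝ≥0∞}
    (hf : ∀ g, Tendsto (fun i => inner ℝ (f i) g) l (𝓝 (inner ℝ f₀ g)))
    (hc : ∃ᶠ i in l, traceForm μ (f i) < c) : traceForm μ f₀ ≤ c := by
  rcases eq_or_ne c ⊤ with rfl | hct
  · exact le_top
  obtain ⟨h, hh, hn⟩ := exists_mem_of_weakly_tendsto (C := √c.toReal)
    (isClosed_weightedGraph μ fun _ => 1) hf (hc.mono fun i hi => by
      obtain ⟨h, hh, hn⟩ := traceForm_lt_iff.1 hi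
      refine ⟨h, by simpa [mem_weightedGraph] using hh, Real.le_sqrt_of_sq_le ?_⟩
      exact (ENNReal.ofReal_le_iff_le_toReal hct).1 hn.le)
  refine (traceForm_le (h := h) (by simpa [mem_weightedGraph] using hh)).trans ?_
  rw [ENNReal.ofReal_le_iff_le_toReal hct]
  calc ‖h‖ ^ 2 ≤ √c.toReal ^ 2 := by gcongr
    _ = c.toReal := Real.sq_sqrt ENNReal.toReal_nonneg

/-! ### The trace form is a transient Dirichlet form -/

/-- If h and k are near-minimisers for u and v, then h ± k compete for u ± v. -/
lemma traceForm_parallelogram_le {μ : Measure ℝ} (u v : Lp ℝ 2 μ) :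
    traceForm μ (u + v) + traceForm μ (u - v) ≤ 2 * (traceForm μ u + traceForm μ v) := by
  refine ENNReal.le_of_forall_pos_le_add fun ε hε hfin => ?_
  have hsum : traceForm μ u + traceForm μ v ≠ ⊤ := fun h => by simp [h] at hfin
  have hε4 : (ε / 4 : ℝ≥0∞) ≠ 0 := by simp [hε.ne']
  obtain ⟨hu, hv⟩ := ENNReal.add_ne_top.1 hsum
  obtain ⟨h, hh, hhn⟩ := traceForm_lt_iff.1 (ENNReal.lt_add_right hu hε4)
  obtain ⟨k, hk, hkn⟩ := traceForm_lt_iff.1 (ENNReal.lt_add_right hv hε4)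
  have h1 : (u + v : Lp ℝ 2 μ) =ᵐ[μ] primitive (h + k) := by
    rw [primitive_add]
    exact (Lp.coeFn_add u v).trans (hh.add hk)
  have h2 : (u - v : Lp ℝ 2 μ) =ᵐ[μ] primitive (h - k) := by
    rw [primitive_sub]
    exact (Lp.coeFn_sub u v).trans (hh.sub hk)
  calc traceForm μ (u + v) + traceForm μ (u - v)
      ≤ ENNReal.ofReal (‖h + k‖ ^ 2) + ENNReal.ofReal (‖h - k‖ ^ 2) :=
        add_le_add (traceForm_le h1) (traceForm_le h2)
    _ = 2 * (ENNReal.ofReal (‖h‖ ^ 2) + ENNReal.ofReal (‖k‖ ^ 2)) := by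
        rw [← ENNReal.ofReal_add (sq_nonneg _) (sq_nonneg _),
          ← ENNReal.ofReal_add (sq_nonneg _) (sq_nonneg _), two_mul,
          ← ENNReal.ofReal_add (by positivity) (by positivity)]
        congr 1
        have := parallelogram_law_with_norm ℝ h k
        linarith
    _ ≤ 2 * ((traceForm μ u + ε / 4) + (traceForm μ v + ε / 4)) := by gcongr
    _ = 2 * (traceForm μ u + traceForm μ v) + 4 * (ε / 4) := by ring
    _ = 2 * (traceForm μ u + traceForm μ v) + ε := by
        rw [ENNReal.mul_div_cancel (by norm_num) (by norm_num)]

lemma traceForm_smul_le {μ : Measure ℝ} {c : ℝ} (hc : c ≠ 0) (u : Lp ℝ 2 μ) :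
    traceForm μ (c • u) ≤ ENNReal.ofReal (c ^ 2) * traceForm μ u := by
  have hc0 : ENNReal.ofReal (c ^ 2) ≠ 0 := by
    rw [Ne, ENNReal.ofReal_eq_zero, not_le]
    positivity
  rw [mul_comm, ← ENNReal.div_le_iff hc0 ENNReal.ofReal_ne_top, le_traceForm_iff]
  intro h hh
  rw [ENNReal.div_le_iff hc0 ENNReal.ofReal_ne_top, ← ENNReal.ofReal_mul (sq_nonneg _)]
  have h1 : (c • u : Lp ℝ 2 μ) =ᵐ[μ] primitive (c • h) := by
    rw [primitive_smul]
    exact (Lp.coeFn_smul c u).trans (hh.const_smul c)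
  refine (traceForm_le h1).trans_eq ?_
  rw [norm_smul, mul_pow, Real.norm_eq_abs, sq_abs, mul_comm]

lemma traceForm_smul {μ : Measure ℝ} (c : ℝ) (u : Lp ℝ 2 μ) :
    traceForm μ (c • u) = ENNReal.ofReal (c ^ 2) * traceForm μ u := by
  rcases eq_or_ne c 0 with rfl | hc
  · have h1 : (0 : Lp ℝ 2 μ) =ᵐ[μ] primitive 0 := by
      rw [primitive_zero]
      exact Lp.coeFn_zero _ _ _
    simpa using traceForm_le h1
  · refine le_antisymm (traceForm_smul_le hc u) ?_
    have h1 := traceForm_smul_le (inv_ne_zero hc) (c • u)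
    rw [inv_smul_smul₀ hc] at h1
    calc ENNReal.ofReal (c ^ 2) * traceForm μ u
        ≤ ENNReal.ofReal (c ^ 2) * (ENNReal.ofReal (c⁻¹ ^ 2) * traceForm μ (c • u)) := by gcongr
      _ = traceForm μ (c • u) := by
        rw [← mul_assoc, ← ENNReal.ofReal_mul (sq_nonneg _), ← mul_pow, mul_inv_cancel₀ hc]
        simp

/-- The reverse inequality is the proved one applied to u + v and u - v, whose sum and difference
are 2u and 2v. -/
lemma traceForm_parallelogram {μ : Measure ℝ} (u v : Lp ℝ 2 μ) :
    traceForm μ (u + v) + traceForm μ (u - v) = 2 * (traceForm μ u + traceForm μ v) := by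
  refine le_antisymm (traceForm_parallelogram_le u v) ?_
  have h1 := traceForm_parallelogram_le (u + v) (u - v)
  rw [show u + v + (u - v) = (2 : ℝ) • u by rw [two_smul]; abel,
    show u + v - (u - v) = (2 : ℝ) • v by rw [two_smul]; abel, traceForm_smul, traceForm_smul,
    ← mul_add, show ENNReal.ofReal (2 ^ 2) = 2 * 2 by
      rw [sq, ENNReal.ofReal_mul zero_le_two]; simp, mul_assoc] at h1
  exact (ENNReal.mul_le_mul_iff_right two_ne_zero ENNReal.ofNat_ne_top).1 h1

/-- Weak lower semicontinuity is available along any filter, here `𝓝 f₀` itself. -/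
lemma lowerSemicontinuous_traceForm (μ : Measure ℝ) : LowerSemicontinuous (traceForm μ) := by
  intro f₀ c hc
  obtain ⟨d, hcd, hd⟩ := exists_between hc
  by_contra hcon
  have h1 : ∃ᶠ f in 𝓝 f₀, traceForm μ f < d := by
    refine (not_eventually.1 hcon).mono fun f hf => (not_lt.1 hf).trans_lt hcd
  exact hd.not_ge (traceForm_le_of_weakly_tendsto (fun g => tendsto_id.inner tendsto_const_nhds) h1)

lemma traceForm_le_of_contraction {μ : Measure ℝ} {φ : ℝ → ℝ} (hφ : ∀ x y, |φ x - φ y| ≤ |x - y|)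
    (hφ0 : φ 0 = 0) {u v : Lp ℝ 2 μ} (huv : v =ᵐ[μ] fun x => φ (u x)) :
    traceForm μ v ≤ traceForm μ u := by
  rw [le_traceForm_iff]
  intro h hh
  obtain ⟨k, hk, hkn⟩ := exists_primitive_comp hφ hφ0 h
  refine (traceForm_le (h := k) ?_).trans (ENNReal.ofReal_le_ofReal (by gcongr))
  filter_upwards [huv, hh] with x hx hx'
  rw [hx, hx', hk]

lemma ae_pos {μ : Measure ℝ} (hμ : μ (Iic 0) = 0) : ∀ᵐ x ∂μ, 0 < x := by
  simpa [ae_iff, Iic] using hμ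

lemma ae_eq_of_eqOn_Ioi {μ : Measure ℝ} (hμ : μ (Iic 0) = 0) {u v : ℝ → ℝ}
    (huv : EqOn u v (Ioi 0)) : u =ᵐ[μ] v := by
  filter_upwards [ae_pos hμ] with x hx using huv hx

lemma exists_primitive_of_contDiff {φ : ℝ → ℝ} (hφ : ContDiff ℝ 1 φ) (hφc : HasCompactSupport φ) :
    ∃ h : EnergySpace, EqOn φ (primitive h) (Ioi 0) := by
  refine MemExtended.exists_primitive ⟨fun s t _ _ => hφ.contDiffOn.absolutelyContinuousOnInterval,
    ?_, hφc.is_zero_at_infty.mono_left atTop_le_cocompact⟩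
  have hd : Continuous (deriv φ) := hφ.continuous_deriv le_rfl
  refine (Continuous.integrable_of_hasCompactSupport (by fun_prop) ?_).integrableOn
  refine hφc.deriv.mono fun x hx => ?_
  contrapose! hx
  simp_all

/-- Test functions have finite energy, so an element orthogonal to the domain vanishes a.e. on
(0,∞), which carries μ. -/
lemma dense_traceForm_ne_top {μ : Measure ℝ} [IsLocallyFiniteMeasure μ] (hμ : μ (Iic 0) = 0) :
    Dense {f : Lp ℝ 2 μ | traceForm μ f ≠ ⊤} := by
  let D : Submodule ℝ (Lp ℝ 2 μ) :=
    { carrier := {f | ∃ h : EnergySpace, f =ᵐ[μ] primitive h}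
      add_mem' := by
        rintro u v ⟨h, hh⟩ ⟨k, hk⟩
        exact ⟨h + k, by rw [primitive_add]; exact (Lp.coeFn_add u v).trans (hh.add hk)⟩
      zero_mem' := ⟨0, by rw [primitive_zero]; exact Lp.coeFn_zero _ _ _⟩
      smul_mem' := by
        rintro c u ⟨h, hh⟩
        exact ⟨c • h, by
          rw [primitive_smul]; exact (Lp.coeFn_smul c u).trans (hh.const_smul c)⟩ }
  suffices hD : Dense (D : Set (Lp ℝ 2 μ)) by
    refine hD.mono fun f hf => ?_
    obtain ⟨h, hh⟩ := hf
    exact traceForm_ne_top hh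
  rw [Submodule.dense_iff_topologicalClosure_eq_top, Submodule.topologicalClosure_eq_top_iff,
    Submodule.eq_bot_iff]
  intro g hg
  have h1 : ∀ᵐ x ∂μ, x ∈ Ioi (0 : ℝ) → g x = 0 := by
    refine isOpen_Ioi.ae_eq_zero_of_integral_contDiff_smul_eq_zero
      (((Lp.memLp g).locallyIntegrable one_le_two).locallyIntegrableOn _) fun φ hφ hφc _ => ?_
    have hmem : MemLp φ 2 μ := hφ.continuous.memLp_of_hasCompactSupport hφc
    obtain ⟨h, hh⟩ := exists_primitive_of_contDiff (hφ.of_le (by simp)) hφc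
    have h2 : hmem.toLp φ ∈ D :=
      ⟨h, (MemLp.coeFn_toLp hmem).trans (ae_eq_of_eqOn_Ioi hμ hh)⟩
    have h3 := (Submodule.mem_orthogonal _ _).1 hg _ h2
    rw [inner_eq_integral] at h3
    rw [← h3]
    refine integral_congr_ae ?_
    filter_upwards [MemLp.coeFn_toLp hmem] with x hx
    rw [hx, smul_eq_mul]
  refine Lp.eq_zero_iff_ae_eq_zero.2 ?_
  filter_upwards [h1, ae_pos hμ] with x hx hx0 using hx hx0

lemma isDirichletForm_traceForm {μ : Measure ℝ} [IsLocallyFiniteMeasure μ] (hμ : μ (Iic 0) = 0) :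
    IsDirichletForm (traceForm μ) where
  parallelogram := traceForm_parallelogram
  homogeneous := traceForm_smul
  closed := lowerSemicontinuous_traceForm μ
  dense := dense_traceForm_ne_top hμ
  markovian u v huv := by
    refine traceForm_le_of_contraction (φ := fun t => min (max t 0) 1) (fun x y => ?_) (by simp) huv
    exact (abs_min_sub_min_le_max _ _ _ _).trans (max_le (by
      simpa using abs_max_sub_max_le_abs x y 0) (by simp))

lemma isTransient_traceForm {μ : Measure ℝ} [SigmaFinite μ] (hμ : μ (Iic 0) = 0) :
    IsTransient (traceForm μ) := by
  obtain ⟨g₀, hg₀, hg₀m, hg₀i⟩ := exists_pos_lintegral_lt_of_sigmaFinite μ one_ne_zero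
  -- `g₀` has integral below 1 and the factor √x matches |u| √x ≤ ‖h‖; the minima keep g bounded and
  -- below `g₀`.
  let g : ℝ → ℝ := fun x => min (g₀ x) 1 * min 1 √x
  have hgm : Measurable g := by fun_prop
  have hg0 : ∀ x, 0 ≤ g x := fun x => by positivity
  have hg1 : ∀ x, g x ≤ 1 := fun x =>
    mul_le_one₀ (min_le_right _ _) (by positivity) (min_le_left _ _)
  have hgg₀ : ∀ x, g x ≤ g₀ x := fun x => by
    calc g x ≤ g₀ x * 1 := by
          simp only [g]
          gcongr
          · exact min_le_left _ _
          · exact min_le_left _ _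
      _ = g₀ x := mul_one _
  refine ⟨g, hgm, ⟨1, fun x => ?_⟩, ⟨hgm.aestronglyMeasurable, ?_⟩, ?_, fun u hu => ?_⟩
  · rw [abs_of_nonneg (hg0 x)]
    exact hg1 x
  · refine lt_of_le_of_lt (lintegral_mono fun x => ?_) (hg₀i.trans ENNReal.one_lt_top)
    rw [Real.enorm_of_nonneg (hg0 x)]
    exact (ENNReal.ofReal_le_ofReal (hgg₀ x)).trans_eq (ENNReal.ofReal_coe_nnreal)
  · filter_upwards [ae_pos hμ] with x hx
    have : 0 < (g₀ x : ℝ) := hg₀ x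
    exact mul_pos (lt_min this one_pos) (lt_min one_pos (Real.sqrt_pos.2 hx))
  · rw [le_traceForm_iff]
    intro h hh
    rw [ENNReal.ofReal_pow (norm_nonneg _)]
    gcongr
    calc ∫⁻ x, ENNReal.ofReal (|u x| * g x) ∂μ ≤ ∫⁻ x, ENNReal.ofReal ‖h‖ * g₀ x ∂μ := by
          refine lintegral_mono_ae ?_
          filter_upwards [hh, ae_pos hμ] with x hx hx0
          rw [← ENNReal.ofReal_coe_nnreal, ← ENNReal.ofReal_mul (norm_nonneg _)]
          refine ENNReal.ofReal_le_ofReal ?_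
          have h1 : |u x| * √x ≤ ‖h‖ := by
            rw [hx]
            refine abs_le_of_sq_le_sq' ?_ (norm_nonneg _) |>.2
            rw [mul_pow, sq_abs, Real.sq_sqrt hx0.le]
            exact (le_div_iff₀ hx0).1 (primitive_sq_le h hx0)
          calc |u x| * g x ≤ |u x| * (g₀ x * √x) := by
                simp only [g]
                gcongr
                · exact min_le_left _ _
                · exact min_le_right _ _
            _ = |u x| * √x * g₀ x := by ring
            _ ≤ ‖h‖ * g₀ x := by gcongr
      _ = ENNReal.ofReal ‖h‖ * ∫⁻ x, g₀ x ∂μ := by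
          rw [lintegral_const_mul' _ _ ENNReal.ofReal_ne_top]
      _ ≤ ENNReal.ofReal ‖h‖ * 1 := by gcongr
      _ = ENNReal.ofReal ‖h‖ := mul_one _

/-! ### Projections onto the orthogonal complement of the kernel -/

/-- The weight turning `lam ∫ u v 2x² dx` into a scalar product of `L²((0,∞))`. -/
def besselWeight (lam x : ℝ) : ℝ := √(2 * lam) * x

lemma besselWeight_mul_mul {lam : ℝ} (hlam : 0 ≤ lam) (x s t : ℝ) :
    besselWeight lam x * s * (besselWeight lam x * t) = lam * (s * t * (2 * x ^ 2)) := by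
  have h1 := Real.mul_self_sqrt (mul_nonneg zero_le_two hlam)
  simp only [besselWeight]
  linear_combination (x ^ 2 * s * t) * h1

/-- The Hilbert space `(𝒟, ℰ_lam)`, as a space of pairs. -/
abbrev domainGraph (lam : ℝ) : Submodule ℝ (WithLp 2 (EnergySpace × EnergySpace)) :=
  weightedGraph (volume.restrict (Ioi (0 : ℝ))) (besselWeight lam)

lemma coeFn_snd_of_mem_domainGraph {lam : ℝ} {u : ℝ → ℝ}
    {p : WithLp 2 (EnergySpace × EnergySpace)} (hp : p ∈ domainGraph lam)
    (hu : EqOn u (primitive p.fst) (Ioi 0)) :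
    p.snd =ᵐ[volume.restrict (Ioi (0 : ℝ))] fun x => besselWeight lam x * u x := by
  filter_upwards [mem_weightedGraph.1 hp, ae_restrict_mem measurableSet_Ioi] with x hx hx0
  rw [hx, hu hx0]

lemma MemBesselDomain.exists_mem_domainGraph {lam : ℝ} (hlam : 0 ≤ lam) {u : ℝ → ℝ}
    (hu : MemBesselDomain u) : ∃ p ∈ domainGraph lam, EqOn u (primitive p.fst) (Ioi 0) := by
  obtain ⟨h, hh⟩ := hu.memExtended.exists_primitive
  have hm : Measurable fun x => besselWeight lam x * primitive h x :=
    (measurable_const.mul measurable_id).mul (measurable_primitive h)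
  have hmem : MemLp (fun x => besselWeight lam x * primitive h x) 2
      (volume.restrict (Ioi (0 : ℝ))) := by
    rw [memLp_two_iff_integrable_sq hm.aestronglyMeasurable]
    refine (hu.sq_integrable.const_mul lam).congr ?_
    filter_upwards [ae_restrict_mem measurableSet_Ioi] with x hx
    rw [hh hx, sq (besselWeight lam x * _), besselWeight_mul_mul hlam, sq]
  exact ⟨WithLp.toLp 2 (h, hmem.toLp _), MemLp.coeFn_toLp hmem, hh⟩

lemma memBesselDomain_of_mem_domainGraph {lam : ℝ} (hlam : 0 < lam) {u : ℝ → ℝ}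
    {p : WithLp 2 (EnergySpace × EnergySpace)} (hp : p ∈ domainGraph lam)
    (hu : EqOn u (primitive p.fst) (Ioi 0)) : MemBesselDomain u := by
  have hext := MemExtended.of_eqOn_primitive hu
  refine ⟨hext.absCont, hext.energy_finite, ?_⟩
  refine ((Lp.memLp p.snd).integrable_sq.const_mul lam⁻¹).congr ?_
  filter_upwards [coeFn_snd_of_mem_domainGraph hp hu] with x hx
  rw [hx, sq (besselWeight lam x * _), besselWeight_mul_mul hlam.le,
    inv_mul_cancel_left₀ hlam.ne', sq (u x)]

/-- This turns `IsProjection` into an orthogonal projection in L² × L², where completeness is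
closedness of the graph. -/
lemma besselForm_eq_inner {lam : ℝ} (hlam : 0 ≤ lam) {u v : ℝ → ℝ}
    {p q : WithLp 2 (EnergySpace × EnergySpace)} (hp : p ∈ domainGraph lam)
    (hq : q ∈ domainGraph lam) (hu : EqOn u (primitive p.fst) (Ioi 0))
    (hv : EqOn v (primitive q.fst) (Ioi 0)) : besselForm lam u v = inner ℝ p q := by
  have h1 : inner ℝ p q = inner ℝ p.fst q.fst + inner ℝ p.snd q.snd := rfl
  rw [h1, inner_eq_integral, inner_eq_integral, besselForm, ← integral_const_mul]
  congr 1
  · refine integral_congr_ae ?_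
    filter_upwards [coeFn_eq_mul_deriv hu, coeFn_eq_mul_deriv hv] with x hx hy
    rw [hx, hy]
    ring
  · refine integral_congr_ae ?_
    filter_upwards [coeFn_snd_of_mem_domainGraph hp hu,
      coeFn_snd_of_mem_domainGraph hq hv] with x hx hy
    rw [hx, hy, besselWeight_mul_mul hlam]

/-- The kernel of the restriction operator, as a subspace of the Hilbert space `(𝒟, ℰ_lam)`. -/
def kerGraph (μ : Measure ℝ) (lam : ℝ) : Submodule ℝ (WithLp 2 (EnergySpace × EnergySpace)) where
  carrier := {p | p ∈ domainGraph lam ∧ primitive p.fst =ᵐ[μ] 0}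
  add_mem' {p q} hp hq := by
    refine ⟨add_mem hp.1 hq.1, ?_⟩
    filter_upwards [hp.2, hq.2] with x hx hy
    simp [hx, hy]
  zero_mem' := ⟨zero_mem _, by simp⟩
  smul_mem' c p hp := by
    refine ⟨Submodule.smul_mem _ c hp.1, ?_⟩
    filter_upwards [hp.2] with x hx
    simp [hx]

lemma isClosed_kerGraph (μ : Measure ℝ) (lam : ℝ) :
    IsClosed (kerGraph μ lam : Set (WithLp 2 (EnergySpace × EnergySpace))) := by
  refine (isClosed_weightedGraph _ _).inter (IsSeqClosed.isClosed fun p p₀ hp hlim => ?_)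
  have h1 : Tendsto (fun n => (p n).fst) atTop (𝓝 p₀.fst) :=
    ((continuous_fst.comp (WithLp.prod_continuous_ofLp 2 _ _)).tendsto p₀).comp hlim
  have h2 : ∀ᵐ x ∂μ, ∀ n, primitive (p n).fst x = 0 := ae_all_iff.2 hp
  show ∀ᵐ x ∂μ, primitive p₀.fst x = 0
  filter_upwards [h2] with x hx
  refine tendsto_nhds_unique (tendsto_primitive h1 x) ?_
  simp [hx]

/-- The projection exists, and it does not increase the form. -/
lemma exists_isProjection {μ : Measure ℝ} (hμ : μ (Iic 0) = 0) {lam : ℝ} (hlam : 0 < lam)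
    {u : ℝ → ℝ} (hu : MemBesselDomain u) :
    ∃ v, IsProjection μ lam u v ∧ besselForm lam v v ≤ besselForm lam u u := by
  obtain ⟨p, hp, hup⟩ := hu.exists_mem_domainGraph hlam.le
  have : CompleteSpace (kerGraph μ lam) := (isClosed_kerGraph μ lam).completeSpace_coe
  -- k is the component in the kernel, so P_lam u corresponds to p - k.
  set k := (kerGraph μ lam).starProjection p with hk
  have hkK : k ∈ kerGraph μ lam := Submodule.starProjection_apply_mem _ _
  have hpk : p - k ∈ domainGraph lam := sub_mem hp hkK.1
  have hv : EqOn (u - primitive k.fst) (primitive (p - k).fst) (Ioi 0) := fun x hx => by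
    simp [hup hx]
  have hort : ∀ w ∈ kerGraph μ lam, inner ℝ (p - k) w = 0 := fun w hw =>
    Submodule.starProjection_inner_eq_zero p w hw
  refine ⟨u - primitive k.fst, ⟨memBesselDomain_of_mem_domainGraph hlam hpk hv, ?_, ?_⟩, ?_⟩
  · rw [sub_sub_cancel]
    exact ⟨memBesselDomain_of_mem_domainGraph hlam hkK.1 fun x _ => rfl, hkK.2⟩
  · rintro w ⟨hw, hw0⟩
    obtain ⟨r, hr, hwr⟩ := hw.exists_mem_domainGraph hlam.le
    rw [besselForm_eq_inner hlam.le hpk hr hv hwr]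
    exact hort r ⟨hr, (ae_eq_of_eqOn_Ioi hμ hwr).symm.trans hw0⟩
  · rw [besselForm_eq_inner hlam.le hpk hpk hv hv, besselForm_eq_inner hlam.le hp hp hup hup,
      real_inner_self_eq_norm_sq, real_inner_self_eq_norm_sq]
    have h1 := norm_add_sq_real (p - k) k
    rw [hort k hkK, sub_add_cancel] at h1
    nlinarith [sq_nonneg ‖k‖]

lemma traceApprox_le {μ : Measure ℝ} (hμ : μ (Iic 0) = 0) {lam : ℝ} (hlam : 0 < lam)
    {u : ℝ → ℝ} {f : Lp ℝ 2 μ} (hu : IsRestriction μ u f) :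
    traceApprox μ lam f ≤ ENNReal.ofReal (besselForm lam u u) := by
  obtain ⟨v, hv, hvu⟩ := exists_isProjection hμ hlam hu.1
  refine le_trans (sInf_le ?_) (ENNReal.ofReal_le_ofReal hvu)
  exact ⟨u, v, hu, hv, rfl⟩

/-- P_lam u is itself a competitor for the minimal energy, and the lam term is nonnegative. -/
lemma traceForm_le_traceApprox {μ : Measure ℝ} (hμ : μ (Iic 0) = 0) {lam : ℝ} (hlam : 0 ≤ lam)
    (f : Lp ℝ 2 μ) : traceForm μ f ≤ traceApprox μ lam f := by
  refine le_sInf ?_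
  rintro e ⟨u, v, hu, hv, rfl⟩
  obtain ⟨h, hh⟩ := hv.1.memExtended.exists_primitive
  have huv : u =ᵐ[μ] v := by
    filter_upwards [hv.2.1.2] with x hx
    simpa [sub_eq_zero] using hx
  refine (traceForm_le ((hu.2.2.trans huv).trans (ae_eq_of_eqOn_Ioi hμ hh))).trans
    (ENNReal.ofReal_le_ofReal ?_)
  rw [norm_sq_eq_energy hh, besselForm]
  simp only [← sq]
  exact le_add_of_nonneg_right (mul_nonneg hlam (integral_nonneg fun x => by positivity))

/-! ### Recovery sequences -/

/-- The soft threshold `t ↦ t - (-ε) ∨ (t ∧ ε)`. -/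
def softThreshold (ε t : ℝ) : ℝ := t - max (-ε) (min t ε)

lemma abs_softThreshold_sub_le {ε : ℝ} (hε : 0 < ε) (s t : ℝ) :
    |softThreshold ε s - softThreshold ε t| ≤ |s - t| := by
  simp only [softThreshold]
  grind

lemma softThreshold_of_abs_le {ε t : ℝ} (ht : |t| ≤ ε) : softThreshold ε t = 0 := by
  simp only [softThreshold]
  grind

lemma abs_softThreshold_sub_self_le {ε : ℝ} (hε : 0 < ε) (t : ℝ) : |softThreshold ε t - t| ≤ ε := by
  simp only [softThreshold]
  grind

lemma abs_softThreshold_sub_self_le_abs {ε : ℝ} (hε : 0 < ε) (t : ℝ) :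
    |softThreshold ε t - t| ≤ |t| := by
  simp only [softThreshold]
  grind

lemma continuous_softThreshold (ε : ℝ) : Continuous (softThreshold ε) := by
  unfold softThreshold
  fun_prop

lemma abs_softThreshold_le_abs {ε : ℝ} (hε : 0 < ε) (t : ℝ) : |softThreshold ε t| ≤ |t| := by
  simpa [softThreshold_of_abs_le (t := 0) (by simpa using hε.le)] using
    abs_softThreshold_sub_le hε t 0

lemma memLp_softThreshold {μ : Measure ℝ} {ε : ℝ} (hε : 0 < ε) (f : Lp ℝ 2 μ) :
    MemLp (fun x => softThreshold ε (f x)) 2 μ :=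
  (Lp.memLp f).mono ((continuous_softThreshold ε).comp_aestronglyMeasurable (Lp.memLp f).1)
    (Eventually.of_forall fun x => abs_softThreshold_le_abs hε (f x))

/-- Dominated convergence: the threshold moves f by at most ε and by at most |f|. -/
lemma tendsto_toLp_softThreshold {μ : Measure ℝ} {ε : ℕ → ℝ} (hε : ∀ n, 0 < ε n)
    (hε0 : Tendsto ε atTop (𝓝 0)) (f : Lp ℝ 2 μ) :
    Tendsto (fun n => (memLp_softThreshold (hε n) f).toLp _) atTop (𝓝 f) := by
  rw [tendsto_iff_norm_sub_tendsto_zero]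
  have h1 : ∀ n, ‖(memLp_softThreshold (hε n) f).toLp _ - f‖ ^ 2 =
      ∫ x, (softThreshold (ε n) (f x) - f x) ^ 2 ∂μ := fun n => by
    rw [norm_sq_eq_integral]
    refine integral_congr_ae ?_
    filter_upwards [Lp.coeFn_sub ((memLp_softThreshold (hε n) f).toLp _) f,
      MemLp.coeFn_toLp (memLp_softThreshold (hε n) f)] with x hx hy
    rw [hx, Pi.sub_apply, hy]
  have h2 : Tendsto (fun n => ∫ x, (softThreshold (ε n) (f x) - f x) ^ 2 ∂μ) atTop
      (𝓝 (∫ _, (0 : ℝ) ∂μ)) := by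
    refine tendsto_integral_of_dominated_convergence (fun x => f x ^ 2) (fun n => ?_)
      (Lp.memLp f).integrable_sq (fun n => Eventually.of_forall fun x => ?_)
      (Eventually.of_forall fun x => ?_)
    · exact ((memLp_softThreshold (hε n) f).1.sub (Lp.memLp f).1).pow 2
    · rw [Real.norm_of_nonneg (sq_nonneg _)]
      exact sq_le_sq.2 (abs_softThreshold_sub_self_le_abs (hε n) _)
    · refine squeeze_zero (fun n => sq_nonneg _) (fun n => ?_)
        (by simpa using hε0.pow 2 : Tendsto (fun n => ε n ^ 2) atTop (𝓝 0))
      rw [← sq_abs]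
      exact pow_le_pow_left₀ (abs_nonneg _) (abs_softThreshold_sub_self_le (hε n) _) 2
  simp only [← h1, integral_zero] at h2
  have h3 := (Real.continuous_sqrt.tendsto _).comp h2
  simpa [Function.comp_def, Real.sqrt_sq (norm_nonneg _)] using h3

/-- A soft threshold of a function of finite energy belongs to `𝒟`. -/
lemma memBesselDomain_softThreshold {ε : ℝ} (hε : 0 < ε) {h : EnergySpace} {E : ℝ}
    (hE : ‖h‖ ^ 2 ≤ E) {lam : ℝ} (hlam : 0 ≤ lam) :
    MemBesselDomain (fun x => softThreshold ε (primitive h x)) ∧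
      besselForm lam (fun x => softThreshold ε (primitive h x))
        (fun x => softThreshold ε (primitive h x)) ≤ E + lam * (2 * E ^ 3 / ε ^ 4) := by
  have hE0 : 0 ≤ E := (sq_nonneg _).trans hE
  obtain ⟨k, hk, hkn⟩ := exists_primitive_comp (abs_softThreshold_sub_le hε)
    (softThreshold_of_abs_le (by simpa using hε.le)) h
  set u : ℝ → ℝ := fun x => softThreshold ε (primitive h x) with hu
  have hku : EqOn u (primitive k) (Ioi 0) := fun x _ => (hk x).symm
  have hext := MemExtended.of_eqOn_primitive hku
  -- Beyond R the bound E/x is below ε², so the threshold gives 0. On (0,R] the integrand is at most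
  -- 2Ex ≤ 2ER, so the integral is at most 2ER² = 2E³/ε⁴.
  set R := E / ε ^ 2 with hR
  have hR0 : 0 ≤ R := by positivity
  have hbound : ∀ x, 0 < x →
      (u x) ^ 2 * (2 * x ^ 2) ≤ (Ioc 0 R).indicator (fun _ => 2 * E * R) x := by
    intro x hx
    have h1 : primitive h x ^ 2 ≤ E / x := (primitive_sq_le h hx).trans (by gcongr)
    by_cases hxR : x ≤ R
    · rw [indicator_of_mem (show x ∈ Ioc 0 R from ⟨hx, hxR⟩)]
      have h2 : u x ^ 2 ≤ E / x :=
        (sq_le_sq.2 (abs_softThreshold_le_abs hε (primitive h x))).trans h1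
      calc (u x) ^ 2 * (2 * x ^ 2) ≤ E / x * (2 * x ^ 2) := by gcongr
        _ = 2 * E * x := by field_simp
        _ ≤ 2 * E * R := by gcongr
    · rw [indicator_of_notMem (fun h : x ∈ Ioc 0 R => hxR h.2)]
      have h2 : primitive h x ^ 2 ≤ ε ^ 2 := by
        refine h1.trans ((div_le_iff₀ hx).2 ?_)
        have := (div_lt_iff₀ (by positivity)).1 (not_le.1 hxR)
        linarith
      have h3 : u x = 0 := softThreshold_of_abs_le (abs_le_of_sq_le_sq h2 hε.le)
      simp [h3]
  have hint : IntegrableOn ((Ioc 0 R).indicator fun _ => 2 * E * R) (Ioi (0 : ℝ)) :=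
    ((integrableOn_const (by simp)).integrable_indicator measurableSet_Ioc).integrableOn
  have hum : Measurable u := (continuous_softThreshold ε).measurable.comp (measurable_primitive h)
  have hsq : IntegrableOn (fun x => (u x) ^ 2 * (2 * x ^ 2)) (Ioi 0) := by
    refine hint.mono' ((hum.pow_const 2).mul (by fun_prop)).aestronglyMeasurable ?_
    filter_upwards [ae_restrict_mem measurableSet_Ioi] with x hx
    rw [Real.norm_of_nonneg (by positivity)]
    exact hbound x hx
  refine ⟨⟨hext.absCont, hext.energy_finite, hsq⟩, ?_⟩
  rw [besselForm]
  simp only [← sq]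
  rw [← norm_sq_eq_energy hku]
  have h1 : ∫ x in Ioi 0, u x ^ 2 * (2 * x ^ 2) ≤ 2 * E ^ 3 / ε ^ 4 := by
    calc ∫ x in Ioi 0, u x ^ 2 * (2 * x ^ 2)
        ≤ ∫ x in Ioi 0, (Ioc 0 R).indicator (fun _ => 2 * E * R) x :=
          setIntegral_mono_on hsq hint measurableSet_Ioi hbound
      _ = R * (2 * E * R) := by
          rw [setIntegral_indicator measurableSet_Ioc, inter_eq_right.2 Ioc_subset_Ioi_self]
          simp [hR0]
      _ = 2 * E ^ 3 / ε ^ 4 := by rw [hR]; field_simp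
  have h2 : ‖k‖ ^ 2 ≤ E := (pow_le_pow_left₀ (norm_nonneg _) hkn 2).trans hE
  gcongr

/-- The choice lam = ε^8 beats the growth ε⁻⁴ of the squared L² norm and leaves a factor ε⁴. -/
lemma traceApprox_softThreshold_le {μ : Measure ℝ} (hμ : μ (Iic 0) = 0) {f : Lp ℝ 2 μ}
    (hf : traceForm μ f ≠ ⊤) {ε : ℝ} (hε : 0 < ε) :
    traceApprox μ (ε ^ 8) ((memLp_softThreshold hε f).toLp _) ≤
      ENNReal.ofReal ((traceForm μ f).toReal + ε +
        2 * ((traceForm μ f).toReal + ε) ^ 3 * ε ^ 4) := by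
  set E := (traceForm μ f).toReal with hE
  have hE0 : 0 ≤ E := ENNReal.toReal_nonneg
  have h1 : traceForm μ f < ENNReal.ofReal (E + ε) := by
    rw [← ENNReal.ofReal_toReal hf]
    exact (ENNReal.ofReal_lt_ofReal_iff (by positivity)).2 (by linarith)
  obtain ⟨h, hh, hn⟩ := traceForm_lt_iff.1 h1
  have hn' : ‖h‖ ^ 2 ≤ E + ε := ((ENNReal.ofReal_lt_ofReal_iff (by positivity)).1 hn).le
  obtain ⟨hdom, hle⟩ := memBesselDomain_softThreshold hε hn' (pow_nonneg hε.le 8)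
  have hae : (fun x => softThreshold ε (f x)) =ᵐ[μ] fun x => softThreshold ε (primitive h x) := by
    filter_upwards [hh] with x hx
    rw [hx]
  refine (traceApprox_le hμ (pow_pos hε 8) ⟨hdom, (memLp_congr_ae hae).1 (memLp_softThreshold hε f),
    (MemLp.coeFn_toLp _).trans hae⟩).trans (ENNReal.ofReal_le_ofReal (hle.trans_eq ?_))
  field_simp

/-- The trace of the Bessel form is the form of minimal energy. -/
lemma isTraceForm_traceForm {μ : Measure ℝ} (hμ : μ (Iic 0) = 0) :
    IsTraceForm μ (traceForm μ) := by
  intro lam hlam hlam0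
  refine ⟨fun u u₀ hu => ?_, fun f => ?_⟩
  · by_contra hcon
    obtain ⟨d, hd1, hd2⟩ := exists_between (not_le.1 hcon)
    have h1 := frequently_lt_of_liminf_lt (by isBoundedDefault) hd1
    exact hd2.not_ge (traceForm_le_of_weakly_tendsto hu
      (h1.mono fun n hn => (traceForm_le_traceApprox hμ (hlam n).le _).trans_lt hn))
  · by_cases hf : traceForm μ f = ⊤
    · exact ⟨fun _ => f, tendsto_const_nhds, by simp [hf]⟩
    let ε : ℕ → ℝ := fun n => √√√(lam n)
    have hε : ∀ n, 0 < ε n := fun n =>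
      Real.sqrt_pos.2 (Real.sqrt_pos.2 (Real.sqrt_pos.2 (hlam n)))
    have hε8 : ∀ n, ε n ^ 8 = lam n := fun n => by
      calc ε n ^ 8 = ((√√√(lam n) ^ 2) ^ 2) ^ 2 := by rw [← pow_mul, ← pow_mul]
        _ = lam n := by
          rw [Real.sq_sqrt (Real.sqrt_nonneg _), Real.sq_sqrt (Real.sqrt_nonneg _),
            Real.sq_sqrt (hlam n).le]
    have hε0 : Tendsto ε atTop (𝓝 0) := by
      have h1 : Continuous fun t : ℝ => √√√t := by fun_prop
      simpa [Function.comp_def] using (h1.tendsto 0).comp hlam0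
    refine ⟨fun n => (memLp_softThreshold (hε n) f).toLp _,
      tendsto_toLp_softThreshold hε hε0 f, ?_⟩
    set E := (traceForm μ f).toReal with hE
    have h1 : Tendsto (fun n => ENNReal.ofReal (E + ε n + 2 * (E + ε n) ^ 3 * ε n ^ 4)) atTop
        (𝓝 (traceForm μ f)) := by
      rw [← ENNReal.ofReal_toReal hf]
      refine ENNReal.tendsto_ofReal ?_
      have h2 : Continuous fun t : ℝ => E + t + 2 * (E + t) ^ 3 * t ^ 4 := by fun_prop
      simpa [Function.comp_def] using (h2.tendsto 0).comp hε0
    rw [← h1.limsup_eq]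
    refine limsup_le_limsup (Eventually.of_forall fun n => ?_)
    have := traceApprox_softThreshold_le hμ hf (hε n)
    rwa [hε8] at this

/-- A recovery sequence for q' converges strongly, hence weakly, and is fed into the liminf
inequality of q. -/
lemma MoscoTendsto.le {H : Type*} [NormedAddCommGroup H] [InnerProductSpace ℝ H]
    {Q : ℕ → H → ℝ≥0∞} {q q' : H → ℝ≥0∞} (hq : MoscoTendsto Q q) (hq' : MoscoTendsto Q q') :
    q ≤ q' := by
  intro u₀
  obtain ⟨u, hu, hlim⟩ := hq'.exists_recovery u₀
  exact (hq.le_liminf u u₀ fun v => hu.inner tendsto_const_nhds).trans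
    ((liminf_le_limsup (u := fun n => Q n (u n))).trans hlim)

lemma IsTraceForm.unique {μ : Measure ℝ} {q q' : Lp ℝ 2 μ → ℝ≥0∞} (hq : IsTraceForm μ q)
    (hq' : IsTraceForm μ q') : q = q' := by
  have h1 := hq (fun n => 1 / ((n : ℝ) + 1)) (fun n => by positivity)
    tendsto_one_div_add_atTop_nhds_zero_nat
  have h2 := hq' (fun n => 1 / ((n : ℝ) + 1)) (fun n => by positivity)
    tendsto_one_div_add_atTop_nhds_zero_nat
  exact le_antisymm (h1.le h2) (h2.le h1)

/-! ### Irreducibility -/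

/-- The absolute value of a primitive with opposite values `±1` at `s` and `t` can be replaced by
the constant `1` on `[s,t]`, which reduces the energy by a fixed amount. -/
lemma exists_primitive_abs_of_sign_change {h : EnergySpace} {s t σ : ℝ} (hs : 1 ≤ s) (hst : s ≤ t)
    (hσ : |σ| = 1) (h_s : primitive h s = σ) (h_t : primitive h t = -σ) :
    ∃ k : EnergySpace, (∀ x, 0 < x → x ∉ Ioo s t → primitive k x = |primitive h x|) ∧
      ‖k‖ ^ 2 + 1 ≤ ‖h‖ ^ 2 := by
  have hs0 : 0 < s := one_pos.trans_le hs
  obtain ⟨g, hg, hgn⟩ := exists_primitive_comp (φ := fun x => |x|)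
    (fun x y => abs_abs_sub_abs_le_abs_sub x y) abs_zero h
  have hgmem : MemLp ((Ioc s t).indicator g) 2 (volume.restrict (Ioi (0 : ℝ))) :=
    (Lp.memLp g).indicator measurableSet_Ioc
  -- The primitive of g equals 1 at both s and t, so removing g on (s,t] replaces it by 1 there and
  -- changes nothing outside.
  set d : EnergySpace := hgmem.toLp _ with hd
  have hdc : d =ᵐ[volume.restrict (Ioi (0 : ℝ))] (Ioc s t).indicator g := MemLp.coeFn_toLp _
  have hd_t : ∀ x, t ≤ x → primitive d x = 0 := by
    intro x hx
    have hx0 : 0 < x := (hs0.trans_le hst).trans_le hx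
    rw [primitive_eq_integral d hx0, neg_eq_zero]
    refine integral_eq_zero_of_ae ?_
    filter_upwards [hdc.filter_mono (ae_mono (Measure.restrict_mono (Ioi_subset_Ioi hx0.le) le_rfl)),
      ae_restrict_mem measurableSet_Ioi] with y hy hy0
    rw [hy, indicator_of_notMem fun h => (hx.trans_lt hy0).not_ge h.2]
    simp
  have hd_mid : ∀ x, x ∈ Icc s t → primitive d x = |primitive h x| - 1 := by
    intro x hx
    have hx0 : 0 < x := hs0.trans_le hx.1
    have h1 := primitive_eq_add_integral d hx0 hx.2
    have h2 := primitive_eq_add_integral g hx0 hx.2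
    have h3 : ∫ y in x..t, y⁻¹ * d y = ∫ y in x..t, y⁻¹ * g y := by
      rw [intervalIntegral.integral_of_le hx.2, intervalIntegral.integral_of_le hx.2]
      refine integral_congr_ae ?_
      filter_upwards [hdc.filter_mono (ae_mono (Measure.restrict_mono
        (fun y hy => hx0.trans hy.1 : Ioc x t ⊆ Ioi 0) le_rfl)),
        ae_restrict_mem measurableSet_Ioc] with y hy hy0
      rw [hy, indicator_of_mem (show y ∈ Ioc s t from ⟨hx.1.trans_lt hy0.1, hy0.2⟩)]
    rw [hd_t t le_rfl, h3] at h1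
    rw [hg, hg, h_t, abs_neg, hσ] at h2
    linarith
  have hd_s : ∀ x, 0 < x → x ≤ s → primitive d x = 0 := by
    intro x hx0 hx
    have h1 := primitive_eq_add_integral d hx0 hx
    rw [hd_mid s ⟨le_rfl, hst⟩, h_s, hσ, sub_self] at h1
    have h3 : ∫ y in x..s, y⁻¹ * d y = 0 := by
      rw [intervalIntegral.integral_of_le hx]
      refine integral_eq_zero_of_ae ?_
      filter_upwards [hdc.filter_mono (ae_mono (Measure.restrict_mono
        (fun y hy => hx0.trans hy.1 : Ioc x s ⊆ Ioi 0) le_rfl)),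
        ae_restrict_mem measurableSet_Ioc] with y hy hy0
      rw [hy, indicator_of_notMem fun h : y ∈ Ioc s t => hy0.2.not_gt h.1]
      simp
    linarith
  -- At a zero z of `primitive h` the primitive of d is -1, so the pointwise bound gives ‖d‖² ≥ z ≥
  -- s ≥ 1.
  have hdn : 1 ≤ ‖d‖ ^ 2 := by
    have hcont : ContinuousOn (primitive h) (uIcc s t) := by
      refine (continuousOn_primitive h).mono fun x hx => ?_
      rw [uIcc_of_le hst] at hx
      exact hs0.trans_le hx.1
    obtain ⟨z, hz, hz0⟩ := intermediate_value_uIcc hcont (show (0 : ℝ) ∈ uIcc _ _ by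
      rw [h_s, h_t]
      rcases le_total 0 σ with h0 | h0
      · exact mem_uIcc_of_ge (by linarith) h0
      · exact mem_uIcc_of_le h0 (by linarith))
    rw [uIcc_of_le hst] at hz
    have hz1 : 1 ≤ z := hs.trans hz.1
    have h1 := primitive_sq_le d (one_pos.trans_le hz1)
    rw [hd_mid z hz, hz0] at h1
    norm_num at h1
    exact h1.trans (div_le_self (sq_nonneg _) hz1)
  -- g - d and d live on disjoint sets, so the energy of d is saved in full.
  have hort : inner ℝ (g - d) d = 0 := by
    rw [inner_eq_integral]
    refine integral_eq_zero_of_ae ?_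
    filter_upwards [Lp.coeFn_sub g d, hdc] with x hx hx'
    rw [hx, Pi.sub_apply, hx']
    by_cases hxs : x ∈ Ioc s t <;> simp [hxs]
  refine ⟨g - d, fun x hx0 hx => ?_, ?_⟩
  · rw [primitive_sub, Pi.sub_apply, hg, sub_eq_self]
    rcases le_or_gt x s with h1 | h1
    · exact hd_s x hx0 h1
    · exact hd_t x (not_lt.1 fun h2 => hx ⟨h1, h2⟩)
  · have h1 := norm_add_sq_real (g - d) d
    rw [hort, sub_add_cancel] at h1
    have h2 : ‖g‖ ^ 2 ≤ ‖h‖ ^ 2 := pow_le_pow_left₀ (norm_nonneg _) hgn 2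
    linarith

/-- A nonnegative, smooth, compactly supported function which is `1` on a given interval. -/
lemma exists_cutoff {s t : ℝ} (hst : s < t) :
    ∃ φ : ℝ → ℝ, ContDiff ℝ 1 φ ∧ HasCompactSupport φ ∧ (∀ x, 0 ≤ φ x) ∧
      ∀ x ∈ Icc s t, φ x = 1 := by
  let b : ContDiffBump ((s + t) / 2) := ⟨(t - s) / 2, t - s, by linarith, by linarith⟩
  refine ⟨b, b.contDiff, b.hasCompactSupport, fun x => b.nonneg, fun x hx => ?_⟩
  refine b.one_of_mem_closedBall ?_
  rw [Metric.mem_closedBall, Real.dist_eq, abs_le]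
  constructor
  · show -((t - s) / 2) ≤ _
    linarith [hx.1]
  · show _ ≤ (t - s) / 2
    linarith [hx.2]

/-! ### Sign changes on invariant sets. -/

section Invariant

variable {μ : Measure ℝ} {A : Set ℝ} {hA : MeasurableSet A}

lemma coeFn_restrictLp (hA : MeasurableSet A) (u : Lp ℝ 2 μ) :
    restrictLp A hA u =ᵐ[μ] A.indicator u :=
  MemLp.coeFn_toLp _

/-- Changing the sign on an invariant set does not change the form. -/
lemma traceForm_sub_of_isInvariant (hinv : IsInvariant (traceForm μ) A hA) {u : Lp ℝ 2 μ}
    (hu : traceForm μ u ≠ ⊤) :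
    traceForm μ (restrictLp A hA u - restrictLp Aᶜ hA.compl u) = traceForm μ u := by
  obtain ⟨-, -, h3⟩ := hinv u hu
  -- By invariance the right-hand side is 2 q[u]; one q[u] cancels.
  have h4 := traceForm_parallelogram (restrictLp A hA u) (restrictLp Aᶜ hA.compl u)
  have h5 : restrictLp A hA u + restrictLp Aᶜ hA.compl u = u := by
    refine Lp.ext ?_
    filter_upwards [Lp.coeFn_add (restrictLp A hA u) (restrictLp Aᶜ hA.compl u),
      coeFn_restrictLp hA u, coeFn_restrictLp hA.compl u] with x h1 h2 h3
    rw [h1, Pi.add_apply, h2, h3]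
    by_cases hx : x ∈ A <;> simp [hx]
  rw [h5, ← h3, two_mul] at h4
  exact (ENNReal.add_right_inj hu).1 h4

lemma coeFn_restrictLp_sub (hA : MeasurableSet A) (u : Lp ℝ 2 μ) :
    ∀ᵐ x ∂μ, (x ∈ A → (restrictLp A hA u - restrictLp Aᶜ hA.compl u : Lp ℝ 2 μ) x = u x) ∧
      (x ∉ A → (restrictLp A hA u - restrictLp Aᶜ hA.compl u : Lp ℝ 2 μ) x = -u x) := by
  filter_upwards [Lp.coeFn_sub (restrictLp A hA u) (restrictLp Aᶜ hA.compl u),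
    coeFn_restrictLp hA u, coeFn_restrictLp hA.compl u] with x h1 h2 h3
  rw [h1, Pi.sub_apply, h2, h3]
  by_cases hx : x ∈ A <;> simp [hx]

/-- For an invariant set `A`, a cutoff function times `1_A - 1_{Aᶜ}` is the restriction of a function
of finite energy, which can be chosen with nearly the energy of the cutoff function. -/
lemma exists_signed_primitive [IsLocallyFiniteMeasure μ] (hμ : μ (Iic 0) = 0)
    (hinv : IsInvariant (traceForm μ) A hA) {φ : ℝ → ℝ} (hφ : ContDiff ℝ 1 φ)
    (hφc : HasCompactSupport φ) :
    ∃ f : Lp ℝ 2 μ, f =ᵐ[μ] φ ∧ ∃ h : EnergySpace,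
      (∀ᵐ x ∂μ, (x ∈ A → primitive h x = φ x) ∧ (x ∉ A → primitive h x = -φ x)) ∧
      ENNReal.ofReal (‖h‖ ^ 2) < traceForm μ f + 1 := by
  have hmem : MemLp φ 2 μ := hφ.continuous.memLp_of_hasCompactSupport hφc
  have hf : hmem.toLp φ =ᵐ[μ] φ := MemLp.coeFn_toLp hmem
  obtain ⟨k, hk⟩ := exists_primitive_of_contDiff hφ hφc
  have hft : traceForm μ (hmem.toLp φ) ≠ ⊤ :=
    traceForm_ne_top (hf.trans (ae_eq_of_eqOn_Ioi hμ hk))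
  -- The slack 1 is exactly the energy saved in `exists_primitive_abs_of_sign_change`.
  have h1 := ENNReal.lt_add_right hft one_ne_zero
  rw [← traceForm_sub_of_isInvariant hinv hft] at h1
  obtain ⟨h, hh, hhn⟩ := traceForm_lt_iff.1 h1
  rw [traceForm_sub_of_isInvariant hinv hft] at hhn
  refine ⟨hmem.toLp φ, hf, h, ?_, hhn⟩
  filter_upwards [hh, hf, coeFn_restrictLp_sub hA (hmem.toLp φ)] with x h2 h3 h4
  rwa [← h2, ← h3]

/-- An invariant set contains both or none of the end points of a gap of the support. -/
lemma mem_iff_mem_of_gap [IsLocallyFiniteMeasure μ] (hμ : μ (Iic 0) = 0)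
    (hinv : IsInvariant (traceForm μ) A hA) {s t : ℝ} (hs : 1 ≤ s) (hst : s < t)
    (hms : μ {s} ≠ 0) (hmt : μ {t} ≠ 0) (hgap : μ (Ioo s t) = 0) : s ∈ A ↔ t ∈ A := by
  obtain ⟨φ, hφ, hφc, hφ0, hφ1⟩ := exists_cutoff hst
  obtain ⟨f, hf, h, hh, hn⟩ := exists_signed_primitive hμ hinv hφ hφc
  -- An almost-everywhere statement holds at every atom.
  have hat : ∀ z, μ {z} ≠ 0 →
      (z ∈ A → primitive h z = φ z) ∧ (z ∉ A → primitive h z = -φ z) := fun z hz => by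
    by_contra hcon
    exact hz (measure_mono_null (singleton_subset_iff.2 hcon) hh)
  have hs' := hat s hms
  have ht' := hat t hmt
  rw [hφ1 s ⟨le_rfl, hst.le⟩] at hs'
  rw [hφ1 t ⟨hst.le, le_rfl⟩] at ht'
  by_contra hne
  obtain ⟨σ, hσ, h1, h2⟩ : ∃ σ : ℝ, |σ| = 1 ∧ primitive h s = σ ∧ primitive h t = -σ := by
    by_cases hsA : s ∈ A
    · exact ⟨1, by simp, hs'.1 hsA, ht'.2 fun htA => hne ⟨fun _ => htA, fun _ => hsA⟩⟩
    · refine ⟨-1, by simp, hs'.2 hsA, ?_⟩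
      rw [neg_neg]
      by_cases htA : t ∈ A
      · exact ht'.1 htA
      · exact absurd ⟨fun h => absurd h hsA, fun h => absurd h htA⟩ hne
  -- The null gap hides the flattening, so k still restricts to φ, with energy strictly below the
  -- minimum.
  obtain ⟨k, hk, hkn⟩ := exists_primitive_abs_of_sign_change hs hst.le hσ h1 h2
  have hfk : f =ᵐ[μ] primitive k := by
    have hgap' : ∀ᵐ x ∂μ, x ∉ Ioo s t := measure_eq_zero_iff_ae_notMem.1 hgap
    filter_upwards [hf, hh, ae_pos hμ, hgap'] with x hx1 hx2 hx3 hx4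
    rw [hx1, hk x hx3 hx4]
    by_cases hxA : x ∈ A
    · rw [hx2.1 hxA, abs_of_nonneg (hφ0 x)]
    · rw [hx2.2 hxA, abs_neg, abs_of_nonneg (hφ0 x)]
  refine hn.not_ge ?_
  calc traceForm μ f + 1 ≤ ENNReal.ofReal (‖k‖ ^ 2) + 1 := by
        gcongr
        exact traceForm_le hfk
    _ = ENNReal.ofReal (‖k‖ ^ 2 + 1) := by
        rw [ENNReal.ofReal_add (sq_nonneg _) zero_le_one, ENNReal.ofReal_one]
    _ ≤ ENNReal.ofReal (‖h‖ ^ 2) := ENNReal.ofReal_le_ofReal hkn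

/-- An invariant set contains almost all or almost none of an interval of the support which ends in
an atom. -/
lemma ae_mem_iff_of_interval [IsLocallyFiniteMeasure μ] (hμ : μ (Iic 0) = 0)
    (hinv : IsInvariant (traceForm μ) A hA) {s t : ℝ} (hs : 0 < s) (hst : s < t) (hmt : μ {t} ≠ 0)
    (hac : volume.restrict (Ioo s t) ≪ μ) : ∀ᵐ x ∂μ, x ∈ Ioo s t → (x ∈ A ↔ t ∈ A) := by
  obtain ⟨φ, hφ, hφc, hφ0, hφ1⟩ := exists_cutoff hst
  obtain ⟨f, hf, h, hh, -⟩ := exists_signed_primitive hμ hinv hφ hφc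
  have hcont : ContinuousOn (primitive h) (Icc s t) :=
    (continuousOn_primitive h).mono fun x hx => hs.trans_le hx.1
  -- The signs square away, and continuity upgrades the almost-everywhere identity to all of [s,t].
  have hsq : EqOn (fun x => primitive h x ^ 2) (fun _ => 1) (Icc s t) := by
    refine Measure.eqOn_Icc_of_ae_eq volume hst.ne ?_ (hcont.pow 2) continuousOn_const
    rw [← restrict_Ioo_eq_restrict_Icc]
    filter_upwards [hac.ae_le hh, ae_restrict_mem measurableSet_Ioo] with x hx hx0
    rw [hφ1 x (Ioo_subset_Icc_self hx0)] at hx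
    by_cases hxA : x ∈ A
    · rw [hx.1 hxA, one_pow]
    · rw [hx.2 hxA]
      norm_num
  have hconst : ∀ x ∈ Icc s t, primitive h x = primitive h t := by
    intro x hx
    have hxt : x ≤ t := hx.2
    have h1 : primitive h x ^ 2 = 1 := hsq hx
    have h2 : primitive h t ^ 2 = 1 := hsq ⟨hst.le, le_rfl⟩
    by_contra hne
    have h3 : primitive h x = -primitive h t :=
      (sq_eq_sq_iff_eq_or_eq_neg.1 (h1.trans h2.symm)).resolve_left hne
    have hc : ContinuousOn (primitive h) (uIcc x t) := by
      rw [uIcc_of_le hxt]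
      exact hcont.mono (Icc_subset_Icc_left hx.1)
    obtain ⟨z, hz, hz0⟩ := intermediate_value_uIcc hc (show (0 : ℝ) ∈ uIcc _ _ by
      rw [h3]
      rcases le_total 0 (primitive h t) with h0 | h0
      · exact mem_uIcc_of_le (by linarith) h0
      · exact mem_uIcc_of_ge h0 (by linarith))
    rw [uIcc_of_le hxt] at hz
    have h4 : primitive h z ^ 2 = 1 := hsq ⟨hx.1.trans hz.1, hz.2⟩
    rw [hz0] at h4
    norm_num at h4
  have ht : (t ∈ A → primitive h t = φ t) ∧ (t ∉ A → primitive h t = -φ t) := by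
    by_contra hcon
    exact hmt (measure_mono_null (singleton_subset_iff.2 hcon) hh)
  rw [hφ1 t ⟨hst.le, le_rfl⟩] at ht
  filter_upwards [hh] with x hx hx0
  rw [hφ1 x (Ioo_subset_Icc_self hx0), hconst x (Ioo_subset_Icc_self hx0)] at hx
  by_cases hxA : x ∈ A <;> by_cases htA : t ∈ A <;> simp only [hxA, htA]
  · linarith [hx.1 hxA, ht.2 htA]
  · linarith [hx.2 hxA, ht.1 htA]

end Invariant

/-! ### The mixed measure -/

section Mixed

variable (a : ℕ+ → ℝ)

/-- The density x² is positive on (0,1) and every atom has positive weight, so only Lebesgue null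
sets of (0,1) avoiding ℕ+ are lost. -/
lemma ae_mixedMeasure_iff (ha : ∀ k, 0 < a k) {p : ℝ → Prop} :
    (∀ᵐ x ∂mixedMeasure a, p x) ↔
      (∀ᵐ x ∂volume.restrict (Ioo (0 : ℝ) 1), p x) ∧ ∀ k : ℕ+, p (k : ℕ) := by
  rw [mixedMeasure, ae_add_measure_iff, Measure.ae_sum_iff]
  refine and_congr ?_ (forall_congr' fun k => ?_)
  · rw [ae_withDensity_iff (by fun_prop)]
    refine ⟨fun h => ?_, fun h => h.mono fun x hx _ => hx⟩
    filter_upwards [h, ae_restrict_mem measurableSet_Ioo] with x hx hx0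
    refine hx ?_
    have : 0 < x := hx0.1
    rw [Ne, ENNReal.ofReal_eq_zero, not_le]
    positivity
  · have : ENNReal.ofReal (a k) ≠ 0 := by simpa using ha k
    rw [Measure.ae_ennreal_smul_measure_iff this, ae_dirac_eq, eventually_pure]

lemma mixedMeasure_Iic (ha : ∀ k, 0 < a k) : mixedMeasure a (Iic 0) = 0 := by
  rw [measure_eq_zero_iff_ae_notMem, ae_mixedMeasure_iff a ha]
  refine ⟨?_, fun k => by simp⟩
  filter_upwards [ae_restrict_mem measurableSet_Ioo] with x hx
  simpa using hx.1

lemma mixedMeasure_singleton (ha : ∀ k, 0 < a k) (k : ℕ+) :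
    mixedMeasure a {((k : ℕ) : ℝ)} ≠ 0 := by
  rw [Ne, measure_eq_zero_iff_ae_notMem, ae_mixedMeasure_iff a ha]
  exact fun h => h.2 k rfl

instance : IsLocallyFiniteMeasure (mixedMeasure a) := by
  refine ⟨fun x => ?_⟩
  obtain ⟨n, hn⟩ := exists_nat_gt x
  refine ⟨Iio n, Iio_mem_nhds hn, ?_⟩
  rw [mixedMeasure, Measure.add_apply, Measure.sum_apply _ measurableSet_Iio]
  refine ENNReal.add_lt_top.2 ⟨?_, ?_⟩
  · refine (measure_mono (subset_univ _)).trans_lt ?_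
    rw [withDensity_apply _ MeasurableSet.univ, Measure.restrict_univ]
    refine (setLIntegral_mono' measurableSet_Ioo (g := fun _ => 1) fun x hx => ?_).trans_lt
      (by simp)
    rw [← ENNReal.ofReal_one]
    exact ENNReal.ofReal_le_ofReal (pow_le_one₀ hx.1.le hx.2.le)
  -- Only atoms k < n meet `Iio n`; the larger index n + 1 is used because n may be 0.
  · rw [tsum_eq_sum (s := Finset.Iic n.succPNat)]
    · refine ENNReal.sum_lt_top.2 fun k _ => ?_
      rw [Measure.smul_apply, smul_eq_mul]
      exact ENNReal.mul_lt_top ENNReal.ofReal_lt_top (measure_lt_top _ _)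
    · intro k hk
      have h1 : n + 1 < (k : ℕ) := by simpa [← PNat.coe_lt_coe] using hk
      have h2 : n ≤ (k : ℕ) := by omega
      simp [measurableSet_Iio, h2]

lemma isIrreducible_traceForm_mixedMeasure (ha : ∀ k, 0 < a k) :
    IsIrreducible (traceForm (mixedMeasure a)) := by
  intro A hA hinv
  have hμ := mixedMeasure_Iic a ha
  have hnat : ∀ n : ℕ, (((n + 1 : ℕ) : ℝ) ∈ A ↔ (1 : ℝ) ∈ A) := by
    intro n
    induction n with
    | zero => simp
    | succ n ih =>
      rw [← ih]
      refine (mem_iff_mem_of_gap hμ hinv (by simp) (by simp) ?_ ?_ ?_).symm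
      · exact mixedMeasure_singleton a ha ⟨n + 1, n.succ_pos⟩
      · exact mixedMeasure_singleton a ha ⟨n + 1 + 1, (n + 1).succ_pos⟩
      · rw [measure_eq_zero_iff_ae_notMem, ae_mixedMeasure_iff a ha]
        constructor
        · filter_upwards [ae_restrict_mem measurableSet_Ioo] with x hx hx'
          have h1 := hx'.1
          push_cast at h1
          linarith [hx.2, n.cast_nonneg (α := ℝ)]
        · rintro k ⟨h1, h2⟩
          have h1' : n + 1 < (k : ℕ) := by exact_mod_cast h1
          have h2' : (k : ℕ) < n + 1 + 1 := by exact_mod_cast h2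
          omega
  -- The shift n + 2 keeps the left end below 1 already for n = 0; the intervals exhaust (0,1) and
  -- end at the atom 1.
  have hint : ∀ᵐ x ∂mixedMeasure a, ∀ n : ℕ, x ∈ Ioo (1 / ((n : ℝ) + 2)) 1 → (x ∈ A ↔ (1 : ℝ) ∈ A) := by
    refine ae_all_iff.2 fun n => ae_mem_iff_of_interval hμ hinv (by positivity) ?_ ?_ ?_
    · rw [div_lt_one (by positivity)]
      linarith [n.cast_nonneg (α := ℝ)]
    · simpa using mixedMeasure_singleton a ha 1
    · refine Measure.AbsolutelyContinuous.trans (Measure.restrict_mono (s' := Ioo 0 1)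
        (Ioo_subset_Ioo_left (by positivity)) le_rfl).absolutelyContinuous ?_
      exact Measure.ae_le_iff_absolutelyContinuous.1 fun p hp => ((ae_mixedMeasure_iff a ha).1 hp).1
  have hall : ∀ᵐ x ∂mixedMeasure a, (x ∈ A ↔ (1 : ℝ) ∈ A) := by
    rw [ae_mixedMeasure_iff a ha]
    constructor
    · filter_upwards [((ae_mixedMeasure_iff a ha).1 hint).1, ae_restrict_mem measurableSet_Ioo]
        with x hx hx0
      obtain ⟨n, hn⟩ := exists_nat_one_div_lt hx0.1
      refine hx n ⟨lt_of_le_of_lt ?_ hn, hx0.2⟩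
      gcongr
      norm_num
    · intro k
      obtain ⟨n, hn⟩ := Nat.exists_eq_succ_of_ne_zero k.ne_zero
      rw [hn]
      exact hnat n
  by_cases h1 : (1 : ℝ) ∈ A
  · right
    rw [measure_eq_zero_iff_ae_notMem]
    filter_upwards [hall] with x hx
    simpa using hx.2 h1
  · left
    rw [measure_eq_zero_iff_ae_notMem]
    filter_upwards [hall] with x hx
    exact fun h => h1 (hx.1 h)

end Mixed

end BesselTrace

end

theorem mainTheorem7 (a : ℕ+ → ℝ) (ha : ∀ k, 0 < a k) :
    (∃! q : Lp ℝ 2 (BesselTrace.mixedMeasure a) → ℝ≥0∞,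
      BesselTrace.IsTraceForm (BesselTrace.mixedMeasure a) q) ∧
    ∀ q : Lp ℝ 2 (BesselTrace.mixedMeasure a) → ℝ≥0∞,
      BesselTrace.IsTraceForm (BesselTrace.mixedMeasure a) q →
        BesselTrace.IsDirichletForm q ∧ BesselTrace.IsTransient q ∧
          BesselTrace.IsIrreducible q := by
  have hμ := BesselTrace.mixedMeasure_Iic a ha
  have htrace := BesselTrace.isTraceForm_traceForm hμ
  refine ⟨⟨_, htrace, fun q hq => hq.unique htrace⟩, fun q hq => ?_⟩
  rw [hq.unique htrace]
  exact ⟨BesselTrace.isDirichletForm_traceForm hμ, BesselTrace.isTransient_traceForm hμ,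
    BesselTrace.isIrreducible_traceForm_mixedMeasure a ha⟩
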